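/- Let $S$ be a Polish space with its Borel $\sigma$-algebra. A rate kernel on $S$ is a measurable kernel $\mu(a,\mathrm db)$ with total rate $\lambda(a)=\mu(a,S)<\infty$ for every $a\in S$. A (non-explosive) Markov jump process with rate kernel $\mu$ is a time-homogeneous Markov process $(Z_t)_{t\ge 0}$ that moves along a Markov chain $(Y_n)$ with transition probabilities $\kappa(a,\cdot)=\mu(a,\cdot)/\lambda(a)$ (and $\kappa(a,\cdot)=\delta_a$ if $\lambda(a)=0$), stays in $Y_n$ for a time $\gamma_n/\lambda(Y_n)$ (forever if $\lambda(Y_n)=0$), where $\gamma_0,\gamma_1,\dots$ are independent standard exponential variables, independent of $(Y_n)$, and whose jump times almost surely increase to infinity. Let $\pi$ be a probability measure on $S$ and $\tilde\pi$ a $\sigma$-finite measure on $S$ with $\pi\ll\tilde\pi$, and let $\frac{\mathrm d\pi}{\mathrm d\tilde\pi}\colon S\to[0,\infty)$ be any measurable version of the density. Let $\mathfrak s\colon S\to S$ be a measurable involution ($\mathfrak s\circ\mathfrak s=\mathrm{id}$) that preserves both $\pi$ and $\tilde\pi$. Let $\tilde\mu$ be a rate kernel in skew-detailed balance with respect to $\mathfrak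 s$ and $\tilde\pi$, that is, $$\int_{S\times S} f(a,b)\,\tilde\pi(\mathrm da)\,\tilde\mu(a,\mathrm db)=\int_{S\times S} f(\mathfrak s(a'),\mathfrak s(b'))\,\tilde\pi(\mathrm db')\,\tilde\mu(b',\mathrm da')$$ for all measurable $f\colon S\times S\to\mathbb R$ for which both sides converge absolutely, and assume $\int_S\tilde\mu(a,S)\,\pi(\mathrm da)<\infty$. Let $g\colon[0,\infty)\to[0,\infty)$ be a monotone (non-decreasing) function with $g(0)=0$, $g(1)=1$ and $g(t)=t\,g(1/t)$ for $t>0$. Put $$\lambda_g(a,b)=\begin{cases} g\!\left(\dfrac{\frac{\mathrm d\pi}{\mathrm d\tilde\pi}(b)}{\frac{\mathrm d\pi}{\mathrm d\tilde\pi}(a)}\right) & \text{if } \frac{\mathrm d\pi}{\mathrm d\tilde\pi}(a)\ne 0,\\ 0&\text{otherwise,}\end{cases}\qquad \lambda_g(a)=\int_S\lambda_g(a,b)\,\tilde\mu(a,\mathrm db),\qquad \lambda_{\mathfrak s}(a)=\bigl(\lambda_g(\mathfrak s(a))-\lambda_g(a)\bigr)^+,$$ and $$\mu(a,\mathrm db)=\lambda_g(a,b)\,\tilde\mu(a,\mathrm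 db)+\lambda_{\mathfrak s}(a)\,\delta_{\mathfrak s(a)}(\mathrm db)$$ (the integral $\lambda_g(a)$ is finite for $\pi$-almost every $a$; where it is infinite, $\lambda_{\mathfrak s}$ is computed in $[0,\infty]$ with $(\infty-\infty)^+=0$). Then, up to a modification of $\mu$ on a $\pi$-null set, the Markov jump process with rate kernel $\mu$ exists and has stationary measure $\pi$. Precisely: there are a rate kernel $\mu'$ with $\mu'(a,\cdot)=\mu(a,\cdot)$ for $\pi$-almost every $a$, and Markov kernels $(P_t)_{t\ge0}$ on $S$, such that for every initial distribution $\nu$ on $S$ there is a non-explosive Markov jump process with rate kernel $\mu'$, transition kernels $(P_t)$ and initial distribution $\nu$, which, if $\nu\ll\pi$, is also a Markov jump process with the unmodified rates $\mu$; and $\int_S P_t(a,B)\,\pi(\mathrm da)=\pi(B)$ for all $t\ge0$ and all Borel $B\subseteq S$. -/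

import Mathlib

open MeasureTheory ProbabilityTheory
open scoped ENNReal NNReal

universe u

namespace JumpSampler

/-- A rate kernel: a measurable kernel whose total rate `λ(a) = μ(a, S)` is finite at every
point. -/
def IsRateKernel {S : Type*} [MeasurableSpace S] (μ : Kernel S S) : Prop :=
  ∀ a, μ a Set.univ < ∞

/-- Skew-detailed balance of `μ` with respect to the map `s` and the measure `m`:
`∫∫ f(a, b) m(da) μ(a, db) = ∫∫ f(s a', s b') m(db') μ(b', da')`
for all measurable real `f` for which both sides are absolutely convergent. -/
def SkewDetailedBalance {S : Type*} [MeasurableSpace S]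
    (μ : Kernel S S) (s : S → S) (m : Measure S) : Prop :=
  ∀ f : S → S → ℝ, Measurable (Function.uncurry f) →
    ∫⁻ a, ∫⁻ b, ‖f a b‖ₑ ∂(μ a) ∂m < ∞ →
    ∫⁻ b', ∫⁻ a', ‖f (s a') (s b')‖ₑ ∂(μ b') ∂m < ∞ →
    ∫ a, ∫ b, f a b ∂(μ a) ∂m = ∫ b', ∫ a', f (s a') (s b') ∂(μ b') ∂m

/-- A monotone balancing function `g : [0, ∞) → [0, ∞)`. -/
structure IsBalancingFunction (g : ℝ≥0 → ℝ≥0) : Prop where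
  monotone : Monotone g
  map_zero : g 0 = 0
  map_one : g 1 = 1
  balance : ∀ t, 0 < t → g t = t * g (1 / t)

/-- `λ_g(a, b) = g(p(b) / p(a))` if `p(a) ≠ 0`, and `0` otherwise, for a density `p`. -/
noncomputable def balancedRate {S : Type*} (g : ℝ≥0 → ℝ≥0) (p : S → ℝ≥0) (a b : S) : ℝ≥0 :=
  open Classical in if p a ≠ 0 then g (p b / p a) else 0

/-- `λ_g(a) = ∫ λ_g(a, b) μ(a, db)`, with values in `[0, ∞]`. -/
noncomputable def totalBalancedRate {S : Type*} [MeasurableSpace S] (g : ℝ≥0 → ℝ≥0)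
    (p : S → ℝ≥0) (μ : Kernel S S) (a : S) : ℝ≥0∞ :=
  ∫⁻ b, (balancedRate g p a b : ℝ≥0∞) ∂(μ a)

/-- The minimal flip rate `λ_s(a) = (λ_g(s a) - λ_g(a))⁺`; subtraction in `[0, ∞]` is truncated
at `0`, hence is the positive part of the difference. -/
noncomputable def flipRate {S : Type*} [MeasurableSpace S] (g : ℝ≥0 → ℝ≥0)
    (p : S → ℝ≥0) (s : S → S) (μ : Kernel S S) (a : S) : ℝ≥0∞ :=
  totalBalancedRate g p μ (s a) - totalBalancedRate g p μ a

/-- The rebalanced rates `λ_g(a, b) μ(a, db) + λ_s(a) δ_{s(a)}(db)`. -/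
noncomputable def rebalanced {S : Type*} [MeasurableSpace S] (g : ℝ≥0 → ℝ≥0)
    (p : S → ℝ≥0) (s : S → S) (μ : Kernel S S) (a : S) : Measure S :=
  (μ a).withDensity (fun b => (balancedRate g p a b : ℝ≥0∞)) +
    flipRate g p s μ a • Measure.dirac (s a)

/-- The jump distribution `κ(a, ·) = μ(a, ·) / λ(a)` at `a`, where `λ(a) = μ(a, S)`;
a point `a` with `λ(a) = 0` is absorbing, with the convention `κ(a, ·) = δ_a`. -/
noncomputable def jumpLaw {S : Type*} [MeasurableSpace S] (μ : S → Measure S) (a : S) :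
    Measure S :=
  open Classical in
  if μ a Set.univ = 0 then Measure.dirac a else (μ a Set.univ)⁻¹ • μ a

/-- The `n`-th jump time `∑_{k < n} γ_k / λ(Y_k)`, where `γ_k / 0 = ∞` for `γ_k > 0`. -/
noncomputable def jumpTime {S Ω : Type*} [MeasurableSpace S] (μ : S → Measure S)
    (Y : ℕ → Ω → S) (γ : ℕ → Ω → ℝ) (n : ℕ) (ω : Ω) : ℝ≥0∞ :=
  ∑ k ∈ Finset.range n, ENNReal.ofReal (γ k ω) / μ (Y k ω) Set.univ

/-- `Z` is the jump-and-hold process, running for all time, with embedded chain `Y` and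
normalized holding times `γ`: the chain `Y` is Markov with transition probabilities `κ`; the
`γ n` are independent standard exponential variables, independent of `Y`; the jump times
increase to infinity (no explosion); and `Z` is equal to `Y n` from the `n`-th jump time
(included) to the next one (excluded). -/
structure IsJumpHold {S Ω : Type*} [MeasurableSpace S] [MeasurableSpace Ω]
    (μ : S → Measure S) (Z : ℝ≥0 → Ω → S) (Pr : Measure Ω)
    (Y : ℕ → Ω → S) (γ : ℕ → Ω → ℝ) : Prop where
  measurable_chain : ∀ n, Measurable (Y n)
  measurable_hold : ∀ n, Measurable (γ n)
  chain : ∀ (n : ℕ) (B : Set S), MeasurableSet B →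
    Pr⟦Y (n + 1) ⁻¹' B | ⨆ k ≤ n, MeasurableSpace.comap (Y k) inferInstance⟧
      =ᵐ[Pr] fun ω => (jumpLaw μ (Y n ω)).real B
  hold_law : ∀ n, Pr.map (γ n) = expMeasure 1
  hold_indep : iIndepFun γ Pr
  chain_indep_hold : IndepFun (fun ω n => Y n ω) (fun ω n => γ n ω) Pr
  nonexplosive : ∀ᵐ ω ∂Pr, ⨆ n, jumpTime μ Y γ n ω = ∞
  path : ∀ᵐ ω ∂Pr, ∀ (n : ℕ) (t : ℝ≥0), jumpTime μ Y γ n ω ≤ t →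
    (t : ℝ≥0∞) < jumpTime μ Y γ (n + 1) ω → Z t ω = Y n ω

/-- Under the probability `Pr`, `Z` is a non-explosive time-homogeneous Markov jump process with
rates `μ`, transition kernels `P` and initial distribution `ν`. The Markov property is with
respect to the filtration generated by `Z`. -/
structure IsMarkovJumpProcess {S Ω : Type*} [MeasurableSpace S] [MeasurableSpace Ω]
    (μ : S → Measure S) (P : ℝ≥0 → Kernel S S) (ν : Measure S)
    (Z : ℝ≥0 → Ω → S) (Pr : Measure Ω) : Prop where
  measurable : ∀ t, Measurable (Z t)
  initial : Pr.map (Z 0) = ν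
  markov : ∀ (r t : ℝ≥0) (B : Set S), MeasurableSet B →
    Pr⟦Z (r + t) ⁻¹' B | ⨆ u ≤ r, MeasurableSpace.comap (Z u) inferInstance⟧
      =ᵐ[Pr] fun ω => (P t (Z r ω)).real B
  jumpHold : ∃ (Y : ℕ → Ω → S) (γ : ℕ → Ω → ℝ), IsJumpHold μ Z Pr Y γ

end JumpSampler

/-! The proof has two halves: flux balance (under `π` the rates carry as much mass into every set as
out of it), and the passage from flux balance to a non-explosive process with stationary law `π`.

Flux balance. Skew-detailed balance says that `(a, b) ↦ (s b, s a)` preserves `πt(da) μt(a, db)`.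
The identity `g t = t * g (1 / t)` makes `p a * λ_g(a, b)` symmetric, and `p ∘ s = p` almost
everywhere, so the exchange also preserves `π(da) λ_g(a, b) μt(a, db)`. Hence the flow into `B`
equals the flow out of `s ⁻¹' B` (`lintegral_balanced`). The flips raise the total rate to `max (λ_g
∘ s) λ_g`, which is `s`-invariant, and since `s` preserves `π` this restores balance. The bound `g t
≤ 1 + t` makes the mean total rate finite.

Construction. The process is an explicit function of its initial point, i.i.d. uniform variables
selecting the jumps and i.i.d. exponential ones. Splitting off one step gives inductions on the
number of jumps; memorylessness gives the Markov property.

Non-explosion (`ae_nonexplosiveFrom`). By flux balance the finite measure `λ π` is invariant for the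
embedded chain, so the shift by one jump preserves a finite measure. By Poincaré recurrence, holding
times above some positive threshold occur infinitely often, and their sum diverges. Exceptional
points lie in a null set that the chain never enters from outside; they are made absorbing.

Stationarity (`invariant_jumpKernel`). Started from `π`, the jumps have space-time intensity at most
`dt λ(b) π(db)`, by induction through the Poisson renewal identity. Weighting arrivals by the
probability of staying until `t` gives `π P_t ≤ π`, hence equality of probability measures. -/

namespace JumpSampler

open Set unitInterval

/-! ### The standard exponential distribution -/

section Exponential

instance isProbabilityMeasure_expMeasure_one : IsProbabilityMeasure (expMeasure 1) :=
  isProbabilityMeasure_expMeasure one_pos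

lemma setLIntegral_Ioi_expMeasure_one {d : ℝ} (hd : 0 ≤ d) (ψ : ℝ → ℝ≥0∞) (hψ : Measurable ψ) :
    ∫⁻ c in Ioi d, ψ c ∂(expMeasure 1) =
      ∫⁻ c in Ioi d, ENNReal.ofReal (Real.exp (-c)) * ψ c := by
  have h1 : expMeasure 1 = volume.withDensity (exponentialPDF 1) := rfl
  have h2 : Measurable (exponentialPDF 1) := (measurable_exponentialPDFReal 1).ennreal_ofReal
  rw [h1, restrict_withDensity measurableSet_Ioi,
    lintegral_withDensity_eq_lintegral_mul _ h2 hψ]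
  refine setLIntegral_congr_fun measurableSet_Ioi fun c hc => ?_
  have : 0 ≤ c := hd.trans (le_of_lt hc)
  simp [exponentialPDF_of_nonneg this]

lemma ae_pos_expMeasure_one : ∀ᵐ c ∂(expMeasure 1), 0 < c := by
  have h : (expMeasure 1) (Iic 0) = 0 := by
    have h2 := cdf_expMeasure_eq one_pos 0
    rw [ProbabilityTheory.cdf_eq_real] at h2
    simpa [measureReal_def, ENNReal.toReal_eq_zero_iff] using h2
  rw [ae_iff]
  convert! h using 2
  ext c
  simp

lemma lintegral_expMeasure_one (ψ : ℝ → ℝ≥0∞) (hψ : Measurable ψ) :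
    ∫⁻ c, ψ c ∂(expMeasure 1) = ∫⁻ c in Ioi 0, ENNReal.ofReal (Real.exp (-c)) * ψ c := by
  rw [← setLIntegral_Ioi_expMeasure_one le_rfl ψ hψ]
  rw [Measure.restrict_eq_self_of_ae_mem (s := Ioi 0) ae_pos_expMeasure_one]

lemma setLIntegral_Ioi_add_right (d : ℝ) (ψ : ℝ → ℝ≥0∞) :
    ∫⁻ c in Ioi d, ψ c = ∫⁻ c in Ioi 0, ψ (c + d) := by
  rw [← lintegral_indicator measurableSet_Ioi, ← lintegral_indicator measurableSet_Ioi,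
    ← lintegral_add_right_eq_self _ d]
  refine lintegral_congr fun c => ?_
  by_cases hc : 0 < c <;> simp [indicator, hc]

/-- The exponential density factorises under translation by `d`; the factor `exp (-d)` is recognised
as the mass of `Ioi d` by testing with `ψ = 1`. -/
lemma expMeasure_one_memoryless {d : ℝ} (hd : 0 ≤ d) (ψ : ℝ → ℝ≥0∞) (hψ : Measurable ψ) :
    ∫⁻ c in Ioi d, ψ c ∂(expMeasure 1) =
      expMeasure 1 (Ioi d) * ∫⁻ c, ψ (c + d) ∂(expMeasure 1) := by
  have key : ∀ ψ : ℝ → ℝ≥0∞, Measurable ψ → ∫⁻ c in Ioi d, ψ c ∂(expMeasure 1) =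
      ENNReal.ofReal (Real.exp (-d)) * ∫⁻ c, ψ (c + d) ∂(expMeasure 1) := by
    intro ψ hψ
    have hm : Measurable fun c => ψ (c + d) := by fun_prop
    rw [setLIntegral_Ioi_expMeasure_one hd ψ hψ, setLIntegral_Ioi_add_right,
      lintegral_expMeasure_one _ hm, ← lintegral_const_mul _ (by fun_prop)]
    refine lintegral_congr fun c => ?_
    rw [neg_add, Real.exp_add, ENNReal.ofReal_mul (Real.exp_nonneg _)]
    ring
  have h1 := key (fun _ => 1) measurable_const
  simp only [lintegral_const, Measure.restrict_apply_univ, measure_univ, one_mul, mul_one] at h1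
  rw [key ψ hψ, h1]

/-- The renewal identity for the Poisson process of rate one. -/
lemma lintegral_expMeasure_one_renewal (ψ : ℝ → ℝ≥0∞) (hψ : Measurable ψ) :
    ∫⁻ c, ψ c ∂(expMeasure 1) + ∫⁻ y in Ioi 0, ∫⁻ c, ψ (y + c) ∂(expMeasure 1) =
      ∫⁻ y in Ioi 0, ψ y := by
  -- The first point has density `exp (-y)`, and the later ones have density equal to the
  -- probability that the first lies before `y`. These add up to 1.
  have hI : ∀ y : ℝ, 0 < y →
      ENNReal.ofReal (Real.exp (-y)) + expMeasure 1 (Iio y) = 1 := by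
    intro y hy
    have h2 := cdf_expMeasure_eq one_pos y
    have hna : NullSingletonClass (expMeasure 1) := by
      have h1 : expMeasure 1 = volume.withDensity (exponentialPDF 1) := rfl
      rw [h1]; infer_instance
    rw [ProbabilityTheory.cdf_eq_real, if_pos hy.le, one_mul] at h2
    have h3 : expMeasure 1 (Iio y) = ENNReal.ofReal (1 - Real.exp (-y)) := by
      rw [← h2, ofReal_measureReal, measure_congr Iio_ae_eq_Iic]
    rw [h3, ← ENNReal.ofReal_add (Real.exp_nonneg _)
      (by simpa using hy.le)]
    simp
  have h1 : ∫⁻ y in Ioi 0, ∫⁻ c, ψ (y + c) ∂(expMeasure 1) =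
      ∫⁻ y in Ioi 0, expMeasure 1 (Iio y) * ψ y := by
    rw [lintegral_lintegral_swap (by fun_prop)]
    have h2 : ∀ᵐ c ∂(expMeasure 1), ∫⁻ y in Ioi 0, ψ (y + c) =
        ∫⁻ y in Ioi 0, (Iio y).indicator (fun _ => ψ y) c := by
      filter_upwards [ae_pos_expMeasure_one] with c hc
      rw [← setLIntegral_Ioi_add_right]
      rw [← lintegral_indicator measurableSet_Ioi, ← lintegral_indicator measurableSet_Ioi]
      refine lintegral_congr fun y => ?_
      by_cases hy : c < y
      · simp [indicator, hy, hc.trans hy]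
      · simp [indicator, hy]
    rw [lintegral_congr_ae h2, lintegral_lintegral_swap]
    · refine lintegral_congr fun y => ?_
      rw [lintegral_indicator measurableSet_Iio, lintegral_const, Measure.restrict_apply_univ,
        mul_comm]
    · refine Measurable.aemeasurable ?_
      have : MeasurableSet {q : ℝ × ℝ | q.1 < q.2} := measurableSet_lt measurable_fst measurable_snd
      exact Measurable.indicator (f := fun q : ℝ × ℝ => ψ q.2) (by fun_prop) this
  rw [h1, lintegral_expMeasure_one ψ hψ, ← lintegral_add_left (by fun_prop)]
  refine setLIntegral_congr_fun measurableSet_Ioi fun y hy => ?_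
  rw [← add_mul, hI y hy, one_mul]

end Exponential

/-! ### Independent noise driving a jump process -/

section Noise

/-- Prepend an element to a sequence. -/
def seqCons {α : Type*} (a : α) (x : ℕ → α) : ℕ → α
  | 0 => a
  | n + 1 => x n

@[simp] lemma seqCons_zero {α : Type*} (a : α) (x : ℕ → α) : seqCons a x 0 = a := rfl

@[simp] lemma seqCons_succ {α : Type*} (a : α) (x : ℕ → α) (n : ℕ) :
    seqCons a x (n + 1) = x n := rfl

@[fun_prop]
lemma measurable_seqCons {α : Type*} [MeasurableSpace α] :
    Measurable fun q : α × (ℕ → α) => seqCons q.1 q.2 := by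
  refine measurable_pi_lambda _ fun n => ?_
  cases n with
  | zero => exact measurable_fst
  | succ n => exact (measurable_pi_apply n).comp measurable_snd

lemma infinitePi_map_seqCons {α : Type*} [MeasurableSpace α] (m : Measure α)
    [IsProbabilityMeasure m] :
    (m.prod (Measure.infinitePi fun _ : ℕ => m)).map (fun q => seqCons q.1 q.2) =
      Measure.infinitePi fun _ : ℕ => m := by
  refine Measure.eq_infinitePi _ fun s t ht => ?_
  rw [Measure.map_apply measurable_seqCons (MeasurableSet.pi s.countable_toSet fun i _ => ht i)]
  classical
  -- Filling the unconstrained coordinates with `univ` replaces an arbitrary finite index set by an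
  -- initial segment, from which coordinate `0` can be split off.
  let t' : ℕ → Set α := fun n => if n ∈ s then t n else univ
  have ht' : ∀ n, MeasurableSet (t' n) := fun n => by
    by_cases h : n ∈ s <;> simp [t', h, ht]
  obtain ⟨N, hN⟩ : ∃ N, s ⊆ Finset.range (N + 1) :=
    ⟨s.sup id, fun i hi => Finset.mem_range.2 (Nat.lt_succ_of_le (Finset.le_sup (f := id) hi))⟩
  have hpre : (fun q : α × (ℕ → α) => seqCons q.1 q.2) ⁻¹' (Set.pi s t) =
      t' 0 ×ˢ (Set.pi (Finset.range N) fun n => t' (n + 1)) := by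
    ext q
    simp only [mem_preimage, Set.mem_pi, Finset.mem_coe, mem_prod, Finset.mem_range, t']
    constructor
    · intro h
      refine ⟨?_, fun n hn => ?_⟩
      · split_ifs with h0
        · exact h 0 h0
        · trivial
      · split_ifs with h0
        · exact h (n + 1) h0
        · trivial
    · rintro ⟨h0, h⟩ n hn
      cases n with
      | zero => simpa [hn] using h0
      | succ n =>
        have := h n (by simpa using hN hn)
        simpa [hn] using this
  rw [hpre, Measure.prod_prod, Measure.infinitePi_pi (fun _ => m) (fun i _ => ht' _), mul_comm,
    ← Finset.prod_range_succ' (fun n => m (t' n)),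
    ← Finset.prod_subset hN]
  · exact Finset.prod_congr rfl fun n hn => by simp [t', hn]
  · intro n _ hn
    simp [t', hn]

/-- The random input of a jump process: uniform variables selecting the jumps, and normalized
holding times. -/
abbrev Noise : Type := (ℕ → I) × (ℕ → ℝ)

/-- The law of the random input: all variables are independent, uniform on `[0, 1]` and standard
exponential, respectively. -/
noncomputable def noiseLaw : Measure Noise :=
  (Measure.infinitePi fun _ : ℕ => (volume : Measure I)).prod
    (Measure.infinitePi fun _ : ℕ => expMeasure 1)

instance : IsProbabilityMeasure noiseLaw := by
  unfold noiseLaw; infer_instance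

lemma ae_hold_pos : ∀ᵐ x ∂noiseLaw, 0 < x.2 0 := by
  have h1 : noiseLaw.map (fun x => x.2 0) = expMeasure 1 := by
    rw [noiseLaw, ← Function.comp_def (fun w : ℕ → ℝ => w 0) Prod.snd,
      ← Measure.map_map (measurable_pi_apply 0) measurable_snd, Measure.map_snd_prod,
      measure_univ, one_smul, Measure.infinitePi_map_eval]
  exact ae_of_ae_map (by fun_prop) (h1 ▸ ae_pos_expMeasure_one)

/-- Prepend the input of one step. -/
def noiseCons (c : ℝ) (u : I) (x : Noise) : Noise := (seqCons u x.1, seqCons c x.2)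

@[fun_prop]
lemma measurable_noiseCons :
    Measurable fun q : ℝ × I × Noise => noiseCons q.1 q.2.1 q.2.2 := by
  unfold noiseCons
  exact (measurable_seqCons.comp (by fun_prop : Measurable fun q : ℝ × I × Noise =>
    (q.2.1, q.2.2.1))).prodMk (measurable_seqCons.comp (by fun_prop :
      Measurable fun q : ℝ × I × Noise => (q.1, q.2.2.2)))

/-- First-step decomposition: once one step is read, the remaining noise is fresh. It drives the
inductions on the number of jumps. -/
lemma lintegral_noiseLaw (Φ : Noise → ℝ≥0∞) (hΦ : Measurable Φ) :
    ∫⁻ x, Φ x ∂noiseLaw =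
      ∫⁻ c, ∫⁻ u, ∫⁻ x, Φ (noiseCons c u x) ∂noiseLaw ∂(volume : Measure I) ∂(expMeasure 1) := by
  have hm : Measurable fun q : ℝ × I × Noise => Φ (noiseCons q.1 q.2.1 q.2.2) :=
    hΦ.comp measurable_noiseCons
  have hm' : ∀ c, Measurable fun q : (ℕ → ℝ) × (I × (ℕ → I)) =>
      Φ (noiseCons c q.2.1 (q.2.2, q.1)) := fun c =>
    hm.comp (by fun_prop : Measurable fun q : (ℕ → ℝ) × (I × (ℕ → I)) =>
      (c, q.2.1, q.2.2, q.1))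
  have hm'' : Measurable fun q : (I × (ℕ → I)) × (ℝ × (ℕ → ℝ)) =>
      Φ (noiseCons q.2.1 q.1.1 (q.1.2, q.2.2)) :=
    hm.comp (by fun_prop : Measurable fun q : (I × (ℕ → I)) × (ℝ × (ℕ → ℝ)) =>
      (q.2.1, q.1.1, q.1.2, q.2.2))
  conv_lhs => rw [noiseLaw, ← infinitePi_map_seqCons (volume : Measure I),
    ← infinitePi_map_seqCons (expMeasure 1),
    Measure.map_prod_map _ _ measurable_seqCons measurable_seqCons]
  rw [lintegral_map hΦ (by fun_prop)]
  simp only [Prod.map]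
  change ∫⁻ q : (I × (ℕ → I)) × (ℝ × (ℕ → ℝ)),
    Φ (noiseCons q.2.1 q.1.1 (q.1.2, q.2.2)) ∂_ = _
  rw [lintegral_prod_symm' _ hm'', lintegral_prod _ (by fun_prop)]
  refine lintegral_congr fun c => ?_
  have h1 : ∀ γ : ℕ → ℝ, ∫⁻ q : I × (ℕ → I), Φ (noiseCons c q.1 (q.2, γ))
      ∂((volume : Measure I).prod (Measure.infinitePi fun _ => volume)) =
      ∫⁻ u : I, ∫⁻ U : ℕ → I, Φ (noiseCons c u (U, γ)) ∂(Measure.infinitePi fun _ => volume) :=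
    fun γ => lintegral_prod _ ((hm' c).comp measurable_prodMk_left).aemeasurable
  simp only [h1]
  have hm3 : Measurable fun q : ((ℕ → ℝ) × I) × (ℕ → I) =>
      Φ (noiseCons c q.1.2 (q.2, q.1.1)) :=
    (hm' c).comp (by fun_prop : Measurable fun q : ((ℕ → ℝ) × I) × (ℕ → I) =>
      (q.1.1, q.1.2, q.2))
  rw [lintegral_lintegral_swap
    (hm3.lintegral_prod_right' (ν := Measure.infinitePi fun _ => volume)).aemeasurable]
  refine lintegral_congr fun u => ?_
  rw [noiseLaw, lintegral_prod_symm']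
  exact hm.comp (by fun_prop : Measurable fun x : Noise => (c, u, x))

end Noise

/-! ### The jump process driven by the noise -/

section Dynamics

variable {S : Type*} {f : S → I → S} {lam : S → ℝ≥0∞} {x₀ : S}

/-- The chain started at `a` that moves from `b` to `f b u` upon reading the input `u`. -/
def chain (f : S → I → S) : S → (ℕ → I) → ℕ → S
  | a, _, 0 => a
  | a, U, n + 1 => chain f (f a (U 0)) (fun k => U (k + 1)) n

@[simp] lemma chain_zero (a : S) (U : ℕ → I) : chain f a U 0 = a := rfl

@[simp] lemma chain_noiseCons_succ (a : S) (c : ℝ) (u : I) (x : Noise) (n : ℕ) :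
    chain f a (noiseCons c u x).1 (n + 1) = chain f (f a u) x.1 n := rfl

/-- The `n`-th jump time, for the rates `lam`. -/
noncomputable def arrival (f : S → I → S) (lam : S → ℝ≥0∞) (n : ℕ) (a : S) (x : Noise) : ℝ≥0∞ :=
  ∑ k ∈ Finset.range n, ENNReal.ofReal (x.2 k) / lam (chain f a x.1 k)

@[simp] lemma arrival_zero (a : S) (x : Noise) : arrival f lam 0 a x = 0 := rfl

lemma arrival_noiseCons_succ (a : S) (c : ℝ) (u : I) (x : Noise) (n : ℕ) :
    arrival f lam (n + 1) a (noiseCons c u x) =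
      ENNReal.ofReal c / lam a + arrival f lam n (f a u) x := by
  simp only [arrival, Finset.sum_range_succ', add_comm]
  rfl

lemma arrival_succ (a : S) (x : Noise) (n : ℕ) :
    arrival f lam (n + 1) a x =
      arrival f lam n a x + ENNReal.ofReal (x.2 n) / lam (chain f a x.1 n) :=
  Finset.sum_range_succ _ _

lemma arrival_mono (a : S) (x : Noise) : Monotone fun n => arrival f lam n a x :=
  monotone_nat_of_le_succ fun n => by simp [arrival_succ]

open Classical in
/-- The position at time `t`; it is `x₀` after an explosion. -/
noncomputable def jumpPath (f : S → I → S) (lam : S → ℝ≥0∞) (x₀ : S) (t : ℝ≥0) (a : S)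
    (x : Noise) : S :=
  if h : ∃ n, (t : ℝ≥0∞) < arrival f lam (n + 1) a x then chain f a x.1 (Nat.find h) else x₀

lemma jumpPath_eq_chain {t : ℝ≥0} {a : S} {x : Noise} {n : ℕ}
    (h1 : arrival f lam n a x ≤ t) (h2 : (t : ℝ≥0∞) < arrival f lam (n + 1) a x) :
    jumpPath f lam x₀ t a x = chain f a x.1 n := by
  classical
  have h : ∃ n, (t : ℝ≥0∞) < arrival f lam (n + 1) a x := ⟨n, h2⟩
  rw [jumpPath, dif_pos h]
  congr 1
  rw [Nat.find_eq_iff]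
  exact ⟨h2, fun k hk => not_lt.2 ((arrival_mono a x (Nat.succ_le_of_lt hk)).trans h1)⟩

lemma jumpPath_eq_default {t : ℝ≥0} {a : S} {x : Noise}
    (h : ∀ n, arrival f lam n a x ≤ t) : jumpPath f lam x₀ t a x = x₀ := by
  rw [jumpPath, dif_neg]
  rintro ⟨n, hn⟩
  exact hn.not_ge (h _)

lemma exists_arrival_le_lt_or (t : ℝ≥0) (a : S) (x : Noise) :
    (∃ n, arrival f lam n a x ≤ t ∧ (t : ℝ≥0∞) < arrival f lam (n + 1) a x) ∨
      ∀ n, arrival f lam n a x ≤ t := by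
  by_cases h : ∀ n, arrival f lam n a x ≤ t
  · exact Or.inr h
  · left
    push Not at h
    classical
    obtain ⟨hn, hlt⟩ := (Nat.find_eq_iff h).1 rfl
    cases hk : Nat.find h with
    | zero => simp [hk] at hn
    | succ k =>
      rw [hk] at hn hlt
      exact ⟨k, not_lt.1 (hlt k k.lt_succ_self), hn⟩

lemma jumpPath_noiseCons_of_lt {t : ℝ≥0} {a : S} {c : ℝ} (u : I) (x : Noise)
    (h : (t : ℝ≥0∞) < ENNReal.ofReal c / lam a) :
    jumpPath f lam x₀ t a (noiseCons c u x) = a :=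
  jumpPath_eq_chain (n := 0) (by simp) (by simpa [arrival_noiseCons_succ] using h)

/-- A first jump at the finite time `r` translates all later arrivals by `r`. Explosion is
unaffected by the translation, so the default value `x₀` agrees on both sides. -/
lemma jumpPath_noiseCons_of_le {t r : ℝ≥0} {a : S} {c : ℝ} (u : I) (x : Noise)
    (hr : ENNReal.ofReal c / lam a = r) :
    jumpPath f lam x₀ (r + t) a (noiseCons c u x) = jumpPath f lam x₀ t (f a u) x := by
  rcases exists_arrival_le_lt_or (f := f) (lam := lam) t (f a u) x with ⟨n, h1, h2⟩ | h
  · rw [jumpPath_eq_chain h1 h2, jumpPath_eq_chain (n := n + 1), chain_noiseCons_succ]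
    · rw [arrival_noiseCons_succ, hr, ENNReal.coe_add]
      gcongr
    · rw [arrival_noiseCons_succ, hr, ENNReal.coe_add]
      exact ENNReal.add_lt_add_left ENNReal.coe_ne_top h2
  · rw [jumpPath_eq_default h, jumpPath_eq_default]
    rintro (_ | n)
    · simp
    · rw [arrival_noiseCons_succ, hr, ENNReal.coe_add]
      gcongr
      exact h n

variable [MeasurableSpace S]

@[fun_prop]
lemma measurable_chain (hf : Measurable (Function.uncurry f)) (n : ℕ) :
    Measurable fun q : S × (ℕ → I) => chain f q.1 q.2 n := by
  induction n with
  | zero => exact measurable_fst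
  | succ n ih =>
    exact ih.comp (g := fun q : S × (ℕ → I) => chain f q.1 q.2 n)
      (f := fun q : S × (ℕ → I) => (f q.1 (q.2 0), fun k => q.2 (k + 1)))
      ((hf.comp (by fun_prop : Measurable fun q : S × (ℕ → I) => (q.1, q.2 0))).prodMk
        (by fun_prop))

lemma measurable_chain_noise (hf : Measurable (Function.uncurry f)) (n : ℕ) :
    Measurable fun q : S × Noise => chain f q.1 q.2.1 n :=
  (measurable_chain hf n).comp (by fun_prop : Measurable fun q : S × Noise => (q.1, q.2.1))

lemma measurable_arrival (hf : Measurable (Function.uncurry f)) (hlam : Measurable lam) (n : ℕ) :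
    Measurable fun q : S × Noise => arrival f lam n q.1 q.2 := by
  unfold arrival
  refine Finset.measurable_sum _ fun k _ => Measurable.div (by fun_prop) ?_
  exact hlam.comp (measurable_chain_noise hf k)

lemma measurable_jumpPath (hf : Measurable (Function.uncurry f)) (hlam : Measurable lam)
    (t : ℝ≥0) : Measurable fun q : S × Noise => jumpPath f lam x₀ t q.1 q.2 := by
  intro B hB
  have h : (fun q : S × Noise => jumpPath f lam x₀ t q.1 q.2) ⁻¹' B =
      (⋃ n, ({q | arrival f lam n q.1 q.2 ≤ t} ∩ {q | (t : ℝ≥0∞) < arrival f lam (n + 1) q.1 q.2} ∩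
        {q | chain f q.1 q.2.1 n ∈ B})) ∪
      ((⋂ n, {q | arrival f lam n q.1 q.2 ≤ t}) ∩ {_q | x₀ ∈ B}) := by
    ext q
    simp only [mem_preimage, mem_union, mem_iUnion, mem_inter_iff, mem_iInter, mem_ofPred_eq]
    constructor
    · intro hq
      rcases exists_arrival_le_lt_or (f := f) (lam := lam) t q.1 q.2 with ⟨n, h1, h2⟩ | h
      · rw [jumpPath_eq_chain h1 h2] at hq
        exact Or.inl ⟨n, ⟨h1, h2⟩, hq⟩
      · rw [jumpPath_eq_default h] at hq
        exact Or.inr ⟨h, hq⟩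
    · rintro (⟨n, ⟨h1, h2⟩, hq⟩ | ⟨h, hq⟩)
      · rwa [jumpPath_eq_chain h1 h2]
      · rwa [jumpPath_eq_default h]
  rw [h]
  have ha := measurable_arrival hf hlam
  refine (MeasurableSet.iUnion fun n => ((measurableSet_le (ha n) measurable_const).inter
    (measurableSet_lt measurable_const (ha _))).inter (measurable_chain_noise hf n hB)).union
    ((MeasurableSet.iInter fun n => measurableSet_le (ha n) measurable_const).inter
      (MeasurableSet.const _))

attribute [irreducible] jumpPath arrival

lemma measurable_jumpPath_right (hf : Measurable (Function.uncurry f)) (hlam : Measurable lam)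
    (t : ℝ≥0) (a : S) : Measurable fun x : Noise => jumpPath f lam x₀ t a x :=
  (measurable_jumpPath hf hlam t).comp (g := fun q : S × Noise => jumpPath f lam x₀ t q.1 q.2)
    (f := fun x => (a, x)) measurable_prodMk_left

lemma measurable_arrival_right (hf : Measurable (Function.uncurry f)) (hlam : Measurable lam)
    (n : ℕ) (a : S) : Measurable fun x : Noise => arrival f lam n a x :=
  (measurable_arrival hf hlam n).comp (g := fun q : S × Noise => arrival f lam n q.1 q.2)
    (f := fun x => (a, x)) measurable_prodMk_left

lemma measurable_lintegral_noise {Φ : S × Noise → ℝ≥0∞} (hΦ : Measurable Φ) :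
    Measurable fun a => ∫⁻ x, Φ (a, x) ∂noiseLaw :=
  hΦ.lintegral_prod_right'

/-- The Markov property of the embedded chain. -/
lemma lintegral_chain_markov (hf : Measurable (Function.uncurry f)) (φ : S → ℝ≥0∞)
    (hφ : Measurable φ) (n : ℕ) :
    ∀ (h : (ℕ → S) → ℝ≥0∞), Measurable h → ∀ a,
      ∫⁻ x, h (fun k => chain f a x.1 (min k n)) * φ (chain f a x.1 (n + 1)) ∂noiseLaw =
      ∫⁻ x, h (fun k => chain f a x.1 (min k n)) *
        (∫⁻ u, φ (f (chain f a x.1 n) u) ∂(volume : Measure I)) ∂noiseLaw := by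
  have hch : ∀ a m, Measurable fun x : Noise => chain f a x.1 m := fun a m =>
    (measurable_chain_noise hf m).comp measurable_prodMk_left
  have hφch : ∀ a m, Measurable fun x : Noise => φ (chain f a x.1 m) := fun a m =>
    hφ.comp (hch a m)
  have hint : Measurable fun a => ∫⁻ u, φ (f a u) ∂(volume : Measure I) :=
    (hφ.comp hf).lintegral_prod_right'
  have hintch : ∀ a m, Measurable fun x : Noise => ∫⁻ u, φ (f (chain f a x.1 m) u)
      ∂(volume : Measure I) := fun a m => hint.comp (hch a m)
  induction n with
  | zero =>
    intro h hh a
    simp only [Nat.min_zero, chain_zero, zero_add]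
    rw [lintegral_const_mul _ (hφch a 1), lintegral_const, measure_univ, mul_one,
      lintegral_noiseLaw _ (hφch a 1)]
    simp [chain_noiseCons_succ]
  | succ n ih =>
    intro h hh a
    have hpre : Measurable fun x : Noise => h fun k => chain f a x.1 (min k (n + 1)) :=
      hh.comp (measurable_pi_lambda _ fun k => hch a _)
    rw [lintegral_noiseLaw _ (hpre.fun_mul (hφch a _)),
      lintegral_noiseLaw _ (hpre.fun_mul (hintch a _))]
    refine lintegral_congr fun c => lintegral_congr fun u => ?_
    -- The past up to step `n + 1` is `a` followed by the past of the restarted chain up to step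
    -- `n`, so induction applies to `h` precomposed with this concatenation.
    have hcons : ∀ x : Noise, (fun k => chain f a (noiseCons c u x).1 (min k (n + 1))) =
        seqCons a fun k => chain f (f a u) x.1 (min k n) := by
      intro x
      funext k
      cases k with
      | zero => simp
      | succ k => simp [Nat.succ_min_succ]
    simp only [hcons, chain_noiseCons_succ]
    exact ih (fun w => h (seqCons a w)) (hh.comp (measurable_seqCons.comp measurable_prodMk_left))
      (f a u)

/-- Memorylessness of the holding time at `a`. -/
lemma setLIntegral_hold_memoryless (hf : Measurable (Function.uncurry f))
    (hlam : Measurable lam) (φ : S → ℝ≥0∞) (hφ : Measurable φ) {a : S} (ha : lam a ≠ ∞)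
    (r t : ℝ≥0) :
    ∫⁻ c in {c : ℝ | (r : ℝ≥0∞) < ENNReal.ofReal c / lam a}, ∫⁻ u, ∫⁻ x,
        φ (jumpPath f lam x₀ (r + t) a (noiseCons c u x)) ∂noiseLaw ∂(volume : Measure I)
        ∂(expMeasure 1) =
      expMeasure 1 {c : ℝ | (r : ℝ≥0∞) < ENNReal.ofReal c / lam a} *
        ∫⁻ x, φ (jumpPath f lam x₀ t a x) ∂noiseLaw := by
  have hφZ : ∀ s, Measurable fun x : Noise => φ (jumpPath f lam x₀ s a x) := fun s =>
    hφ.comp (measurable_jumpPath_right hf hlam s a)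
  have hψm : ∀ s, Measurable fun c => ∫⁻ u, ∫⁻ x,
      φ (jumpPath f lam x₀ s a (noiseCons c u x)) ∂noiseLaw ∂(volume : Measure I) := by
    intro s
    have h1 : Measurable fun q : (ℝ × I) × Noise =>
        φ (jumpPath f lam x₀ s a (noiseCons q.1.1 q.1.2 q.2)) :=
      (hφZ _).comp (measurable_noiseCons.comp
        (by fun_prop : Measurable fun q : (ℝ × I) × Noise => (q.1.1, q.1.2, q.2)))
    exact (h1.lintegral_prod_right' (ν := noiseLaw)).lintegral_prod_right'
      (ν := (volume : Measure I))
  have hra : (r : ℝ≥0∞) * lam a ≠ ∞ := ENNReal.mul_ne_top ENNReal.coe_ne_top ha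
  -- This covers `lam a = 0` too: both sides are then `Ioi 0`, since `c / 0 = ∞` for `c > 0`.
  have hAI : {c : ℝ | (r : ℝ≥0∞) < ENNReal.ofReal c / lam a} =
      Ioi ((r : ℝ≥0∞) * lam a).toReal := by
    ext c
    rw [mem_ofPred_eq, ENNReal.lt_div_iff_mul_lt (Or.inr ENNReal.coe_ne_top)
      (Or.inl ha), mem_Ioi, ENNReal.lt_ofReal_iff_toReal_lt hra]
  rw [hAI, expMeasure_one_memoryless ENNReal.toReal_nonneg _ (hψm _),
    lintegral_noiseLaw _ (hφZ t)]
  congr 1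
  refine lintegral_congr_ae ?_
  filter_upwards [ae_pos_expMeasure_one] with c hc
  refine lintegral_congr fun u => lintegral_congr fun x => ?_
  congr 1
  -- Lengthening the normalized holding time by `r * lam a` delays the first jump by exactly `r`, so
  -- the path at `r + t` becomes the undelayed path at `t`.
  have hs : ENNReal.ofReal (c + ((r : ℝ≥0∞) * lam a).toReal) / lam a =
      ENNReal.ofReal c / lam a + r := by
    rw [ENNReal.ofReal_add hc.le ENNReal.toReal_nonneg, ENNReal.ofReal_toReal hra]
    by_cases h0 : lam a = 0
    · rw [h0, mul_zero, add_zero, ENNReal.div_zero (by simpa using hc), top_add]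
    · rw [ENNReal.add_div, ENNReal.mul_div_cancel_right h0 ha]
  rcases lt_or_ge (t : ℝ≥0∞) (ENNReal.ofReal c / lam a) with hlt | hle
  · rw [jumpPath_noiseCons_of_lt _ _ hlt, jumpPath_noiseCons_of_lt]
    rw [hs, add_comm, ENNReal.coe_add]
    exact ENNReal.add_lt_add_right ENNReal.coe_ne_top hlt
  · obtain ⟨d, hd⟩ : ∃ d : ℝ≥0, (d : ℝ≥0∞) = ENNReal.ofReal c / lam a :=
      ⟨_, ENNReal.coe_toNNReal (ne_top_of_le_ne_top ENNReal.coe_ne_top hle)⟩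
    rw [← hd] at hle
    obtain ⟨t', rfl⟩ := le_iff_exists_add.1 (ENNReal.coe_le_coe.1 hle)
    rw [jumpPath_noiseCons_of_le _ _ hd.symm, ← add_assoc, add_comm r d,
      jumpPath_noiseCons_of_le]
    rw [hs, ENNReal.coe_add, hd]

/-- The Markov property of the jump process, before the `n`-th jump. -/
lemma lintegral_jumpPath_markov_of_lt (hf : Measurable (Function.uncurry f))
    (hlam : Measurable lam) (hfin : ∀ a, lam a ≠ ∞) (φ : S → ℝ≥0∞) (hφ : Measurable φ)
    (t : ℝ≥0) (n : ℕ) :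
    ∀ (h : (ℝ≥0 → S) → ℝ≥0∞), Measurable h → ∀ (r : ℝ≥0) (a : S),
      ∫⁻ x, {x | (r : ℝ≥0∞) < arrival f lam n a x}.indicator (fun x =>
        h (fun v => jumpPath f lam x₀ (min v r) a x) *
          φ (jumpPath f lam x₀ (r + t) a x)) x ∂noiseLaw =
      ∫⁻ x, {x | (r : ℝ≥0∞) < arrival f lam n a x}.indicator (fun x =>
        h (fun v => jumpPath f lam x₀ (min v r) a x) *
          ∫⁻ y, φ (jumpPath f lam x₀ t (jumpPath f lam x₀ r a x) y) ∂noiseLaw) x ∂noiseLaw := by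
  have hZ : ∀ s a, Measurable fun x : Noise => jumpPath f lam x₀ s a x := fun s a =>
    measurable_jumpPath_right hf hlam s a
  have hT : ∀ m a, Measurable fun x : Noise => arrival f lam m a x := fun m a =>
    measurable_arrival_right hf hlam m a
  set Q : S → ℝ≥0∞ := fun a => ∫⁻ y, φ (jumpPath f lam x₀ t a y) ∂noiseLaw with hQ
  have hP : Measurable Q :=
    measurable_lintegral_noise (hφ.comp (measurable_jumpPath hf hlam t))
  induction n with
  | zero => simp
  | succ n ih =>
    intro h hh r a
    have hpre : Measurable fun x : Noise => h fun v => jumpPath f lam x₀ (min v r) a x :=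
      hh.comp (measurable_pi_lambda _ fun k => hZ _ _)
    have hφZ : ∀ s, Measurable fun x : Noise => φ (jumpPath f lam x₀ s a x) := fun s =>
      hφ.comp (hZ s a)
    have hPZ : Measurable fun x : Noise => Q (jumpPath f lam x₀ r a x) := hP.comp (hZ r a)
    have hset : MeasurableSet {x : Noise | (r : ℝ≥0∞) < arrival f lam (n + 1) a x} :=
      measurableSet_lt measurable_const (hT _ _)
    change _ = ∫⁻ x, {x | (r : ℝ≥0∞) < arrival f lam (n + 1) a x}.indicator (fun x =>
        h (fun v => jumpPath f lam x₀ (min v r) a x) * Q (jumpPath f lam x₀ r a x)) x ∂noiseLaw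
    rw [lintegral_noiseLaw _ ((hpre.fun_mul (hφZ _)).indicator hset),
      lintegral_noiseLaw _ ((hpre.fun_mul hPZ).indicator hset)]
    -- `A` is the event that the first jump comes after `r`. On it the past is constant and
    -- memorylessness applies; off it the process restarts at a time `d ≤ r`, and induction covers
    -- the remaining time `r'`.
    set A : Set ℝ := {c : ℝ | (r : ℝ≥0∞) < ENNReal.ofReal c / lam a} with hAdef
    have hA : MeasurableSet A := measurableSet_lt measurable_const (by fun_prop)
    rw [← lintegral_add_compl _ hA]
    conv_rhs => rw [← lintegral_add_compl _ hA]
    congr 1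
    · have hmem : ∀ c ∈ A, ∀ u x,
          noiseCons c u x ∈ {x : Noise | (r : ℝ≥0∞) < arrival f lam (n + 1) a x} := by
        intro c hc u x
        rw [mem_ofPred_eq, arrival_noiseCons_succ]
        exact lt_of_lt_of_le hc le_self_add
      have hpast : ∀ c ∈ A, ∀ u x,
          (fun v => jumpPath f lam x₀ (min v r) a (noiseCons c u x)) = fun _ => a := by
        intro c hc u x
        funext v
        refine jumpPath_noiseCons_of_lt u x (lt_of_le_of_lt ?_ hc)
        exact_mod_cast min_le_right v r
      have hL : ∀ c ∈ A, ∫⁻ u, ∫⁻ x,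
          {x | (r : ℝ≥0∞) < arrival f lam (n + 1) a x}.indicator (fun x =>
            h (fun v => jumpPath f lam x₀ (min v r) a x) * φ (jumpPath f lam x₀ (r + t) a x))
            (noiseCons c u x) ∂noiseLaw ∂(volume : Measure I) =
          h (fun _ => a) * ∫⁻ u, ∫⁻ x, φ (jumpPath f lam x₀ (r + t) a (noiseCons c u x))
            ∂noiseLaw ∂(volume : Measure I) := by
        intro c hc
        have h1 : Measurable fun q : I × Noise =>
            φ (jumpPath f lam x₀ (r + t) a (noiseCons c q.1 q.2)) :=
          (hφZ _).comp (measurable_noiseCons.comp measurable_prodMk_left)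
        rw [← lintegral_const_mul _ (h1.lintegral_prod_right' (ν := noiseLaw))]
        refine lintegral_congr fun u => ?_
        have h2 : Measurable fun x => φ (jumpPath f lam x₀ (r + t) a (noiseCons c u x)) :=
          h1.comp measurable_prodMk_left
        rw [← lintegral_const_mul _ h2]
        refine lintegral_congr fun x => ?_
        rw [indicator_of_mem (hmem c hc u x), hpast c hc u x]
      have hR : ∀ c ∈ A, ∫⁻ u, ∫⁻ x,
          {x | (r : ℝ≥0∞) < arrival f lam (n + 1) a x}.indicator (fun x =>
            h (fun v => jumpPath f lam x₀ (min v r) a x) * Q (jumpPath f lam x₀ r a x))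
            (noiseCons c u x) ∂noiseLaw ∂(volume : Measure I) =
          h (fun _ => a) * Q a := by
        intro c hc
        have h1 : ∀ u x, {x | (r : ℝ≥0∞) < arrival f lam (n + 1) a x}.indicator (fun x =>
            h (fun v => jumpPath f lam x₀ (min v r) a x) * Q (jumpPath f lam x₀ r a x))
            (noiseCons c u x) = h (fun _ => a) * Q a := fun u x => by
          rw [indicator_of_mem (hmem c hc u x), hpast c hc u x, jumpPath_noiseCons_of_lt u x hc]
        simp only [h1, lintegral_const, measure_univ, mul_one]
      have h1 : Measurable fun c => ∫⁻ u, ∫⁻ x,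
          φ (jumpPath f lam x₀ (r + t) a (noiseCons c u x)) ∂noiseLaw ∂(volume : Measure I) := by
        have h1 : Measurable fun q : (ℝ × I) × Noise =>
            φ (jumpPath f lam x₀ (r + t) a (noiseCons q.1.1 q.1.2 q.2)) :=
          (hφZ _).comp (measurable_noiseCons.comp
            (by fun_prop : Measurable fun q : (ℝ × I) × Noise => (q.1.1, q.1.2, q.2)))
        exact (h1.lintegral_prod_right' (ν := noiseLaw)).lintegral_prod_right'
          (ν := (volume : Measure I))
      rw [setLIntegral_congr_fun hA hL, setLIntegral_congr_fun hA hR, lintegral_const_mul _ h1,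
        setLIntegral_const, hAdef, setLIntegral_hold_memoryless hf hlam φ hφ (hfin a), mul_assoc,
        mul_comm (Q a)]
    · refine setLIntegral_congr_fun hA.compl fun c hc => lintegral_congr fun u => ?_
      have hle : ENNReal.ofReal c / lam a ≤ r := not_lt.1 hc
      obtain ⟨d, hd⟩ : ∃ d : ℝ≥0, (d : ℝ≥0∞) = ENNReal.ofReal c / lam a :=
        ⟨_, ENNReal.coe_toNNReal (ne_top_of_le_ne_top ENNReal.coe_ne_top hle)⟩
      obtain ⟨r', rfl⟩ := le_iff_exists_add.1 (ENNReal.coe_le_coe.1 (hd ▸ hle))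
      have hmem : ∀ x, noiseCons c u x ∈
          {x | ((d + r' : ℝ≥0) : ℝ≥0∞) < arrival f lam (n + 1) a x} ↔
          x ∈ {x | (r' : ℝ≥0∞) < arrival f lam n (f a u) x} := by
        intro x
        rw [mem_ofPred_eq, mem_ofPred_eq, arrival_noiseCons_succ, ← hd, ENNReal.coe_add]
        exact ENNReal.add_lt_add_iff_left ENNReal.coe_ne_top
      have hpath : ∀ x, (fun v => jumpPath f lam x₀ (min v (d + r')) a (noiseCons c u x)) =
          fun v => if v < d then a else
            (fun v => jumpPath f lam x₀ (min v r') (f a u) x) (v - d) := by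
        intro x
        funext v
        split_ifs with hv
        · refine jumpPath_noiseCons_of_lt u x ?_
          rw [← hd, min_eq_left (hv.le.trans le_self_add)]
          exact_mod_cast hv
        · obtain ⟨v', rfl⟩ := le_iff_exists_add.1 (not_lt.1 hv)
          rw [min_add_add_left, jumpPath_noiseCons_of_le _ _ hd.symm, add_tsub_cancel_left]
      -- The past is expressed through the restarted path: constant `a` before `d`, then that path
      -- delayed by `d`. Hence the induction over all `h`, `r` and `a` at once.
      have key := ih (fun w => h fun v => if v < d then a else w (v - d))
        (hh.comp (measurable_pi_lambda _ fun v => by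
          by_cases hv : v < d
          · simp only [hv, if_true, measurable_const]
          · simpa only [hv, if_false] using measurable_pi_apply _)) r' (f a u)
      refine Eq.trans (lintegral_congr fun x => ?_) (key.trans (lintegral_congr fun x => ?_))
      · by_cases hx : noiseCons c u x ∈
            {x | ((d + r' : ℝ≥0) : ℝ≥0∞) < arrival f lam (n + 1) a x}
        · rw [indicator_of_mem hx, indicator_of_mem ((hmem x).1 hx), hpath, add_assoc,
            jumpPath_noiseCons_of_le _ _ hd.symm]
        · rw [indicator_of_notMem hx, indicator_of_notMem (mt (hmem x).2 hx)]
      · by_cases hx : noiseCons c u x ∈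
            {x | ((d + r' : ℝ≥0) : ℝ≥0∞) < arrival f lam (n + 1) a x}
        · rw [indicator_of_mem hx, indicator_of_mem ((hmem x).1 hx), hpath,
            jumpPath_noiseCons_of_le _ _ hd.symm]
        · rw [indicator_of_notMem hx, indicator_of_notMem (mt (hmem x).2 hx)]

end Dynamics

/-! ### The driven process is a Markov jump process -/

section General

/-- The past of a process is generated by the stopped process. -/
lemma iSup_comap_le_comap_min {S Ω ι : Type*} [MeasurableSpace S] [LinearOrder ι]
    (X : ι → Ω → S) (r : ι) :
    ⨆ u ≤ r, MeasurableSpace.comap (X u) inferInstance ≤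
      MeasurableSpace.comap (fun ω v => X (min v r) ω) MeasurableSpace.pi := by
  refine iSup₂_le fun u hu => ?_
  have h : X u = (fun w : ι → S => w u) ∘ fun ω v => X (min v r) ω := by
    funext ω
    simp [min_eq_left hu]
  rw [h, ← MeasurableSpace.comap_comp]
  exact MeasurableSpace.comap_mono (measurable_pi_apply u).comap_le

/-- Reduces conditional probabilities to identities between `ℝ≥0∞`-valued integrals, the form in
which the Markov properties are proved. -/
lemma condExp_indicator_ae_eq {Ω : Type*} {m m₀ : MeasurableSpace Ω} (hm : m ≤ m₀)
    {Pr : Measure Ω} [IsProbabilityMeasure Pr] {A : Set Ω} (hA : MeasurableSet A)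
    {G : Ω → ℝ≥0∞} (hG : Measurable[m] G) (hG1 : ∀ ω, G ω ≤ 1)
    (h : ∀ s, MeasurableSet[m] s → Pr (s ∩ A) = ∫⁻ ω in s, G ω ∂Pr) :
    Pr⟦A | m⟧ =ᵐ[Pr] fun ω => (G ω).toReal := by
  have hGm : Measurable G := hG.mono hm le_rfl
  have hGi : Integrable (fun ω => (G ω).toReal) Pr := by
    refine integrable_toReal_of_lintegral_ne_top hGm.aemeasurable (ne_top_of_le_ne_top
      ENNReal.one_ne_top ((lintegral_mono hG1).trans ?_))
    simp
  symm
  refine ae_eq_condExp_of_forall_setIntegral_eq hm ((integrable_const 1).indicator hA)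
    (fun s _ _ => hGi.integrableOn) (fun s hs _ => ?_)
    hG.ennreal_toReal.stronglyMeasurable.aestronglyMeasurable
  rw [integral_toReal hGm.aemeasurable
    (Filter.Eventually.of_forall fun ω => (hG1 ω).trans_lt ENNReal.one_lt_top), ← h s hs,
    integral_indicator hA, setIntegral_const, smul_eq_mul, mul_one, measureReal_restrict_apply hA,
    inter_comm]
  rfl

end General

/-- The first holding variable is positive and rates are finite, so no jump occurs at time `0`. The
null set does not depend on `a`, which allows a random start. -/
lemma ae_jumpPath_zero_eq {S : Type*} {f : S → I → S} {lam : S → ℝ≥0∞} {x₀ : S}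
    (hfin : ∀ a, lam a ≠ ∞) :
    ∀ᵐ x ∂noiseLaw, ∀ a, jumpPath f lam x₀ 0 a x = a := by
  filter_upwards [ae_hold_pos] with x hx a
  rw [jumpPath_eq_chain (n := 0) (by simp), chain_zero]
  rw [arrival_succ, arrival_zero, zero_add]
  exact ENNReal.div_pos (by simpa using hx) (hfin _)

section Driven

variable {S : Type*} [MeasurableSpace S] {f : S → I → S} {lam : S → ℝ≥0∞} {x₀ : S}

/-- Almost surely, the process started at `a` does not explode. -/
def NonexplosiveFrom (f : S → I → S) (lam : S → ℝ≥0∞) (a : S) : Prop :=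
  ∀ᵐ x ∂noiseLaw, ⨆ n, arrival f lam n a x = ∞

/-- The transition kernels of the jump process. -/
noncomputable def jumpKernel (f : S → I → S) (lam : S → ℝ≥0∞) (x₀ : S) (t : ℝ≥0) : Kernel S S :=
  (Kernel.id ×ₖ Kernel.const S noiseLaw).map fun q => jumpPath f lam x₀ t q.1 q.2

lemma jumpKernel_apply (hf : Measurable (Function.uncurry f)) (hlam : Measurable lam) (t : ℝ≥0)
    (a : S) : jumpKernel f lam x₀ t a = noiseLaw.map (jumpPath f lam x₀ t a) := by
  rw [jumpKernel, Kernel.map_apply _ (measurable_jumpPath hf hlam t), Kernel.prod_apply,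
    Kernel.id_apply, Kernel.const_apply, Measure.dirac_prod,
    Measure.map_map (measurable_jumpPath hf hlam t) measurable_prodMk_left]
  rfl

lemma isMarkovKernel_jumpKernel (hf : Measurable (Function.uncurry f)) (hlam : Measurable lam)
    (t : ℝ≥0) : IsMarkovKernel (jumpKernel f lam x₀ t) :=
  Kernel.IsMarkovKernel.map _ (measurable_jumpPath hf hlam t)

lemma jumpKernel_apply_eq_lintegral (hf : Measurable (Function.uncurry f))
    (hlam : Measurable lam) (t : ℝ≥0) (a : S) {B : Set S} (hB : MeasurableSet B) :
    jumpKernel f lam x₀ t a B =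
      ∫⁻ x, B.indicator 1 (jumpPath f lam x₀ t a x) ∂noiseLaw := by
  rw [jumpKernel_apply hf hlam, ← lintegral_map (measurable_one.indicator hB)
    (measurable_jumpPath_right hf hlam t a), lintegral_indicator_one hB]

/-- The Markov property of the jump process. -/
lemma lintegral_jumpPath_markov (hf : Measurable (Function.uncurry f))
    (hlam : Measurable lam) (hfin : ∀ a, lam a ≠ ∞) (φ : S → ℝ≥0∞) (hφ : Measurable φ)
    (h : (ℝ≥0 → S) → ℝ≥0∞) (hh : Measurable h) (r t : ℝ≥0) {a : S}
    (ha : NonexplosiveFrom f lam a) :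
    ∫⁻ x, h (fun v => jumpPath f lam x₀ (min v r) a x) *
        φ (jumpPath f lam x₀ (r + t) a x) ∂noiseLaw =
      ∫⁻ x, h (fun v => jumpPath f lam x₀ (min v r) a x) *
        ∫⁻ y, φ (jumpPath f lam x₀ t (jumpPath f lam x₀ r a x) y) ∂noiseLaw ∂noiseLaw := by
  -- Without explosion the events that the `n`-th jump comes after `r` increase to full measure, so
  -- the restricted Markov property passes to the supremum.
  have hE : ∀ n, MeasurableSet {x : Noise | (r : ℝ≥0∞) < arrival f lam n a x} := fun n =>
    measurableSet_lt measurable_const (measurable_arrival_right hf hlam n a)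
  have hdir : Directed (· ⊆ ·) fun n => {x : Noise | (r : ℝ≥0∞) < arrival f lam n a x} :=
    directed_of_isDirected_le fun m n hmn x (hx : _ < _) =>
      lt_of_lt_of_le hx (arrival_mono a x hmn)
  have hU : ∀ᵐ x ∂noiseLaw, x ∈ ⋃ n, {x : Noise | (r : ℝ≥0∞) < arrival f lam n a x} := by
    filter_upwards [ha] with x hx
    have : (r : ℝ≥0∞) < ⨆ n, arrival f lam n a x := hx ▸ ENNReal.coe_lt_top
    obtain ⟨n, hn⟩ := lt_iSup_iff.1 this
    exact mem_iUnion.2 ⟨n, hn⟩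
  have key : ∀ Φ : Noise → ℝ≥0∞, ∫⁻ x, Φ x ∂noiseLaw =
      ⨆ n, ∫⁻ x, {x : Noise | (r : ℝ≥0∞) < arrival f lam n a x}.indicator Φ x ∂noiseLaw := by
    intro Φ
    conv_lhs => rw [← Measure.restrict_eq_self_of_ae_mem hU, setLIntegral_iUnion_of_directed _ hdir]
    simp only [lintegral_indicator (hE _)]
  rw [key]
  conv_rhs => rw [key]
  exact iSup_congr fun n => lintegral_jumpPath_markov_of_lt hf hlam hfin φ hφ t n h hh r a

/-- The law of the driving noise with a random initial point. -/
noncomputable abbrev startLaw (ν : Measure S) : Measure (S × Noise) := ν.prod noiseLaw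

lemma map_hold_startLaw (ν : Measure S) [IsProbabilityMeasure ν] :
    (startLaw ν).map (fun ω => ω.2.2) = Measure.infinitePi fun _ => expMeasure 1 := by
  rw [startLaw, ← Function.comp_def (fun x : Noise => x.2) Prod.snd,
    ← Measure.map_map measurable_snd measurable_snd, Measure.map_snd_prod, measure_univ, one_smul,
    noiseLaw]
  exact (Measure.map_snd_prod).trans (by rw [measure_univ, one_smul])

lemma map_hold_apply_startLaw (ν : Measure S) [IsProbabilityMeasure ν] (n : ℕ) :
    (startLaw ν).map (fun ω => ω.2.2 n) = expMeasure 1 := by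
  have h := map_hold_startLaw ν
  rw [← Function.comp_def (fun w : ℕ → ℝ => w n) (fun ω : S × Noise => ω.2.2),
    ← Measure.map_map (measurable_pi_apply n) (by fun_prop), h]
  exact Measure.infinitePi_map_eval _ _

/-- The chain depends only on the initial point and the uniform variables; after reassociating the
product, the holding variables are the other factor. -/
lemma indepFun_chain_hold (hf : Measurable (Function.uncurry f)) (ν : Measure S)
    [IsProbabilityMeasure ν] :
    IndepFun (fun (ω : S × Noise) n => chain f ω.1 ω.2.1 n) (fun ω n => ω.2.2 n)
      (startLaw ν) := by
  have hY : Measurable fun (q : S × (ℕ → I)) n => chain f q.1 q.2 n :=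
    measurable_pi_lambda _ fun n => measurable_chain hf n
  have hY' : Measurable fun (ω : S × Noise) n => chain f ω.1 ω.2.1 n :=
    measurable_pi_lambda _ fun n => measurable_chain_noise hf n
  have hg : Measurable fun (ω : S × Noise) n => ω.2.2 n := by fun_prop
  have h := indepFun_prod (μ := ν.prod (Measure.infinitePi fun _ : ℕ => (volume : Measure I)))
    (ν := Measure.infinitePi fun _ : ℕ => expMeasure 1) hY measurable_id
  have hassoc : startLaw ν = ((ν.prod (Measure.infinitePi fun _ : ℕ => (volume : Measure I))).prod
      (Measure.infinitePi fun _ : ℕ => expMeasure 1)).map MeasurableEquiv.prodAssoc :=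
    Measure.prodAssoc_prod.symm
  rw [indepFun_iff_map_prod_eq_prod_map_map hY'.aemeasurable hg.aemeasurable, hassoc,
    Measure.map_map (hY'.prodMk hg) (MeasurableEquiv.measurable _),
    Measure.map_map hY' (MeasurableEquiv.measurable _),
    Measure.map_map hg (MeasurableEquiv.measurable _)]
  exact (indepFun_iff_map_prod_eq_prod_map_map
    (hY.comp measurable_fst).aemeasurable (measurable_id.comp measurable_snd).aemeasurable).1 h

/-- Each event of the past is a preimage under the stopped chain, so its indicator is a functional
`h` of that chain. The Markov identity for a fixed start is then integrated over `ν`. -/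
lemma condExp_chain (hf : Measurable (Function.uncurry f)) (ν : Measure S)
    [IsProbabilityMeasure ν] (n : ℕ) {B : Set S} (hB : MeasurableSet B) :
    (startLaw ν)⟦(fun ω => chain f ω.1 ω.2.1 (n + 1)) ⁻¹' B |
        ⨆ k ≤ n, MeasurableSpace.comap (fun ω : S × Noise => chain f ω.1 ω.2.1 k) inferInstance⟧
      =ᵐ[startLaw ν] fun ω => ((volume : Measure I).map (f (chain f ω.1 ω.2.1 n))).real B := by
  have hfa : ∀ a, Measurable (f a) := fun a => hf.of_uncurry_left
  have hY : ∀ n, Measurable fun ω : S × Noise => chain f ω.1 ω.2.1 n := measurable_chain_noise hf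
  have hφ : Measurable (B.indicator (1 : S → ℝ≥0∞)) := measurable_one.indicator hB
  have hint : Measurable fun a => ∫⁻ u, B.indicator 1 (f a u) ∂(volume : Measure I) :=
    (hφ.comp hf).lintegral_prod_right'
  have hker : ∀ a, (volume : Measure I).map (f a) B = ∫⁻ u, B.indicator 1 (f a u) := fun a => by
    rw [← lintegral_map hφ (hfa a), lintegral_indicator_one hB]
  simp only [measureReal_def, hker]
  have hle : ⨆ k ≤ n, MeasurableSpace.comap (fun ω : S × Noise => chain f ω.1 ω.2.1 k)
      inferInstance ≤ (inferInstance : MeasurableSpace (S × Noise)) :=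
    iSup₂_le fun k _ => (hY k).comap_le
  refine condExp_indicator_ae_eq hle (hY (n + 1) hB) ?_ (fun ω => ?_) fun s hs => ?_
  · exact hint.comp (measurable_iff_comap_le.2
      (le_iSup₂_of_le (f := fun k (_ : k ≤ n) => MeasurableSpace.comap
        (fun ω : S × Noise => chain f ω.1 ω.2.1 k) inferInstance) n le_rfl le_rfl))
  · refine (lintegral_mono (g := fun _ => 1) fun u => ?_).trans (by simp)
    exact indicator_le_self' (fun _ _ => zero_le) _
  · have hs0 := hle s hs
    obtain ⟨M, hM, rfl⟩ := iSup_comap_le_comap_min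
      (fun k (ω : S × Noise) => chain f ω.1 ω.2.1 k) n s hs
    have hhM : Measurable (M.indicator (1 : (ℕ → S) → ℝ≥0∞)) := measurable_one.indicator hM
    have hpast : Measurable fun ω : S × Noise => M.indicator (1 : (ℕ → S) → ℝ≥0∞)
        fun k => chain f ω.1 ω.2.1 (min k n) :=
      hhM.comp (measurable_pi_lambda _ fun k => hY _)
    have hfut : Measurable fun ω : S × Noise => B.indicator (1 : S → ℝ≥0∞)
        (chain f ω.1 ω.2.1 (n + 1)) := hφ.comp (hY _)
    have hfut' : Measurable fun ω : S × Noise =>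
        ∫⁻ u, B.indicator 1 (f (chain f ω.1 ω.2.1 n) u) ∂(volume : Measure I) := hint.comp (hY _)
    rw [← lintegral_indicator_one (hs0.inter (hY (n + 1) hB)), ← lintegral_indicator hs0]
    have e1 : ∀ ω : S × Noise, ((fun ω k => chain f ω.1 ω.2.1 (min k n)) ⁻¹' M ∩
        (fun ω => chain f ω.1 ω.2.1 (n + 1)) ⁻¹' B).indicator (1 : S × Noise → ℝ≥0∞) ω =
        M.indicator (1 : (ℕ → S) → ℝ≥0∞) (fun k => chain f ω.1 ω.2.1 (min k n)) *
          B.indicator (1 : S → ℝ≥0∞) (chain f ω.1 ω.2.1 (n + 1)) := by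
      intro ω
      simp only [indicator, mem_inter_iff, mem_preimage, Pi.one_apply]
      split_ifs <;> simp_all
    have e2 : ∀ ω : S × Noise, ((fun ω k => chain f ω.1 ω.2.1 (min k n)) ⁻¹' M).indicator
        (fun ω => ∫⁻ u, B.indicator 1 (f (chain f ω.1 ω.2.1 n) u) ∂(volume : Measure I)) ω =
        M.indicator (1 : (ℕ → S) → ℝ≥0∞) (fun k => chain f ω.1 ω.2.1 (min k n)) *
          ∫⁻ u, B.indicator 1 (f (chain f ω.1 ω.2.1 n) u) ∂(volume : Measure I) := by
      intro ω
      simp only [indicator, mem_preimage, Pi.one_apply]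
      split_ifs <;> simp_all
    simp only [e1]
    rw [lintegral_congr e2, lintegral_prod _ (hpast.fun_mul hfut).aemeasurable,
      lintegral_prod _ (hpast.fun_mul hfut').aemeasurable]
    exact lintegral_congr fun a => lintegral_chain_markov hf _ hφ n _ hhM a

lemma condExp_jumpPath (hf : Measurable (Function.uncurry f)) (hlam : Measurable lam)
    (hfin : ∀ a, lam a ≠ ∞) (hne : ∀ a, NonexplosiveFrom f lam a) (ν : Measure S)
    [IsProbabilityMeasure ν] (r t : ℝ≥0) {B : Set S} (hB : MeasurableSet B) :
    (startLaw ν)⟦(fun ω => jumpPath f lam x₀ (r + t) ω.1 ω.2) ⁻¹' B |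
        ⨆ u ≤ r, MeasurableSpace.comap (fun ω : S × Noise => jumpPath f lam x₀ u ω.1 ω.2)
          inferInstance⟧
      =ᵐ[startLaw ν] fun ω =>
        (jumpKernel f lam x₀ t (jumpPath f lam x₀ r ω.1 ω.2)).real B := by
  have hZ : ∀ t, Measurable fun ω : S × Noise => jumpPath f lam x₀ t ω.1 ω.2 :=
    measurable_jumpPath hf hlam
  have hmk := isMarkovKernel_jumpKernel (x₀ := x₀) hf hlam t
  have hφ : Measurable (B.indicator (1 : S → ℝ≥0∞)) := measurable_one.indicator hB
  have hint : Measurable fun a => jumpKernel f lam x₀ t a B := Kernel.measurable_coe _ hB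
  simp only [measureReal_def]
  have hle : ⨆ u ≤ r, MeasurableSpace.comap (fun ω : S × Noise => jumpPath f lam x₀ u ω.1 ω.2)
      inferInstance ≤ (inferInstance : MeasurableSpace (S × Noise)) :=
    iSup₂_le fun k _ => (hZ k).comap_le
  refine condExp_indicator_ae_eq hle (hZ (r + t) hB) ?_ (fun ω => prob_le_one) fun s hs => ?_
  · exact hint.comp (measurable_iff_comap_le.2
      (le_iSup₂_of_le (f := fun k (_ : k ≤ r) => MeasurableSpace.comap
        (fun ω : S × Noise => jumpPath f lam x₀ k ω.1 ω.2) inferInstance) r le_rfl le_rfl))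
  · have hs0 := hle s hs
    obtain ⟨M, hM, rfl⟩ := iSup_comap_le_comap_min
      (fun k (ω : S × Noise) => jumpPath f lam x₀ k ω.1 ω.2) r s hs
    have hhM : Measurable (M.indicator (1 : (ℝ≥0 → S) → ℝ≥0∞)) := measurable_one.indicator hM
    have hpast : Measurable fun ω : S × Noise => M.indicator (1 : (ℝ≥0 → S) → ℝ≥0∞)
        fun k => jumpPath f lam x₀ (min k r) ω.1 ω.2 :=
      hhM.comp (measurable_pi_lambda _ fun k => hZ _)
    have hfut : Measurable fun ω : S × Noise => B.indicator (1 : S → ℝ≥0∞)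
        (jumpPath f lam x₀ (r + t) ω.1 ω.2) := hφ.comp (hZ _)
    have hfut' : Measurable fun ω : S × Noise =>
        jumpKernel f lam x₀ t (jumpPath f lam x₀ r ω.1 ω.2) B := hint.comp (hZ _)
    rw [← lintegral_indicator_one (hs0.inter (hZ (r + t) hB)), ← lintegral_indicator hs0]
    have e1 : ∀ ω : S × Noise, ((fun ω k => jumpPath f lam x₀ (min k r) ω.1 ω.2) ⁻¹' M ∩
        (fun ω => jumpPath f lam x₀ (r + t) ω.1 ω.2) ⁻¹' B).indicator (1 : S × Noise → ℝ≥0∞) ω =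
        M.indicator (1 : (ℝ≥0 → S) → ℝ≥0∞) (fun k => jumpPath f lam x₀ (min k r) ω.1 ω.2) *
          B.indicator (1 : S → ℝ≥0∞) (jumpPath f lam x₀ (r + t) ω.1 ω.2) := by
      intro ω
      simp only [indicator, mem_inter_iff, mem_preimage, Pi.one_apply]
      split_ifs <;> simp_all
    have e2 : ∀ ω : S × Noise, ((fun ω k => jumpPath f lam x₀ (min k r) ω.1 ω.2) ⁻¹' M).indicator
        (fun ω => jumpKernel f lam x₀ t (jumpPath f lam x₀ r ω.1 ω.2) B) ω =
        M.indicator (1 : (ℝ≥0 → S) → ℝ≥0∞) (fun k => jumpPath f lam x₀ (min k r) ω.1 ω.2) *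
          jumpKernel f lam x₀ t (jumpPath f lam x₀ r ω.1 ω.2) B := by
      intro ω
      simp only [indicator, mem_preimage, Pi.one_apply]
      split_ifs <;> simp_all
    simp only [e1]
    rw [lintegral_congr e2, lintegral_prod _ (hpast.fun_mul hfut).aemeasurable,
      lintegral_prod _ (hpast.fun_mul hfut').aemeasurable]
    refine lintegral_congr fun a => ?_
    simp only [jumpKernel_apply_eq_lintegral hf hlam t _ hB]
    exact lintegral_jumpPath_markov hf hlam hfin _ hφ _ hhM r t (hne a)

/-- The driven process is a Markov jump process for all rates that, along almost every path, have
total mass `lam` and jump distribution `volume.map (f ·)`. -/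
theorem isMarkovJumpProcess_jumpPath (hf : Measurable (Function.uncurry f))
    (hlam : Measurable lam) (hfin : ∀ a, lam a ≠ ∞) (hne : ∀ a, NonexplosiveFrom f lam a)
    (ν : Measure S) [IsProbabilityMeasure ν] (μ : S → Measure S)
    (hμlam : ∀ᵐ ω ∂(startLaw ν), ∀ n, μ (chain f ω.1 ω.2.1 n) univ = lam (chain f ω.1 ω.2.1 n))
    (hμf : ∀ᵐ ω ∂(startLaw ν), ∀ n,
      jumpLaw μ (chain f ω.1 ω.2.1 n) = (volume : Measure I).map (f (chain f ω.1 ω.2.1 n))) :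
    IsMarkovJumpProcess μ (jumpKernel f lam x₀) ν
      (fun t ω => jumpPath f lam x₀ t ω.1 ω.2) (startLaw ν) where
  measurable := measurable_jumpPath hf hlam
  initial := by
    have h : ∀ᵐ ω ∂(startLaw ν), jumpPath f lam x₀ 0 ω.1 ω.2 = ω.1 :=
      (Measure.quasiMeasurePreserving_snd (μ := ν) (ν := noiseLaw)).ae
        (ae_jumpPath_zero_eq hfin) |>.mono fun ω hω => hω ω.1
    rw [Measure.map_congr h]
    exact (Measure.map_fst_prod).trans (by rw [measure_univ, one_smul])
  markov r t B hB := condExp_jumpPath hf hlam hfin hne ν r t hB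
  jumpHold := by
    -- The jump times see `μ` only along the chain, so agreement there suffices. This later admits
    -- the unmodified rates.
    have harr : ∀ᵐ ω ∂(startLaw ν), ∀ n, jumpTime μ (fun n ω => chain f ω.1 ω.2.1 n)
        (fun n ω => ω.2.2 n) n ω = arrival f lam n ω.1 ω.2 := by
      filter_upwards [hμlam] with ω hω n
      unfold jumpTime arrival
      simp only [hω]
    refine ⟨fun n ω => chain f ω.1 ω.2.1 n, fun n ω => ω.2.2 n, measurable_chain_noise hf,
      fun n => by fun_prop, fun n B hB => ?_, map_hold_apply_startLaw ν, ?_,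
      indepFun_chain_hold hf ν, ?_, ?_⟩
    · refine (condExp_chain hf ν n hB).trans ?_
      filter_upwards [hμf] with ω hω
      rw [hω n]
    · rw [iIndepFun_iff_map_fun_eq_infinitePi_map fun n => by fun_prop]
      simp only [map_hold_apply_startLaw]
      exact map_hold_startLaw ν
    · have h : ∀ᵐ ω ∂(startLaw ν), ⨆ n, arrival f lam n ω.1 ω.2 = ∞ := by
        refine (Measure.ae_prod_iff_ae_ae ?_).2 (Filter.Eventually.of_forall hne)
        exact (Measurable.iSup fun n => measurable_arrival hf hlam n) (measurableSet_singleton ∞)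
      filter_upwards [h, harr] with ω h1 h2
      simpa only [h2] using h1
    · filter_upwards [harr] with ω hω n t h1 h2
      rw [hω] at h1 h2
      exact jumpPath_eq_chain h1 h2

end Driven

/-! ### Invariant measures of the jump process -/

section Scaling

lemma lintegral_Ioi_scale {l : ℝ} (hl : 0 < l) (h : ℝ → ℝ≥0∞) (hh : Measurable h) :
    ∫⁻ y in Ioi 0, h y = ENNReal.ofReal l * ∫⁻ r in Ioi (0 : ℝ), h (l * r) := by
  rw [← lintegral_indicator measurableSet_Ioi, ← lintegral_indicator measurableSet_Ioi]
  conv_lhs => rw [← Real.smul_map_volume_mul_left hl.ne']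
  rw [lintegral_smul_measure, lintegral_map (hh.indicator measurableSet_Ioi) (by fun_prop),
    abs_of_pos hl, smul_eq_mul]
  congr 1
  refine lintegral_congr fun r => ?_
  simp [indicator, hl]

/-- For `D ≥ 0`, count `0` as a point of a rate-one Poisson process, whose later points have
Lebesgue intensity. Exactly one point is the last one in `[0, D]`, so the probabilities that the
next point exceeds `D`, summed over the points, give 1. The proof complements the renewal identity
for the indicator of `Iic D` and cancels the finite quantity `ENNReal.ofReal D`. -/
lemma expMeasure_one_residual (D : ℝ) :
    expMeasure 1 (Ioi D) +
      ∫⁻ y in Ioi 0, (Iic D).indicator (fun y => expMeasure 1 {c | D < y + c}) y = 1 := by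
  have hm : Measurable fun y => expMeasure 1 {c | D < y + c} := by
    have : MeasurableSet {q : ℝ × ℝ | D < q.1 + q.2} :=
      measurableSet_lt measurable_const (by fun_prop)
    exact measurable_measure_prodMk_left this
  have h := lintegral_expMeasure_one_renewal ((Iic D).indicator 1)
    (measurable_one.indicator measurableSet_Iic)
  have h1 : ∫⁻ y in Ioi 0, (Iic D).indicator (1 : ℝ → ℝ≥0∞) y = ENNReal.ofReal D := by
    rw [lintegral_indicator_one measurableSet_Iic, Measure.restrict_apply measurableSet_Iic,
      inter_comm, Ioi_inter_Iic, Real.volume_Ioc, sub_zero]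
  have h2 : ∀ y, ∫⁻ c, (Iic D).indicator (1 : ℝ → ℝ≥0∞) (y + c) ∂(expMeasure 1) =
      expMeasure 1 {c | y + c ≤ D} := by
    intro y
    rw [← lintegral_indicator_one (measurableSet_le (by fun_prop) measurable_const)]
    rfl
  have h3 : (∫⁻ y in Ioi 0, (Iic D).indicator (fun y => expMeasure 1 {c | D < y + c}) y) +
      ∫⁻ y in Ioi 0, expMeasure 1 {c | y + c ≤ D} = ENNReal.ofReal D := by
    rw [← lintegral_add_left (hm.indicator measurableSet_Iic), ← h1]
    refine setLIntegral_congr_fun measurableSet_Ioi fun y hy => ?_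
    by_cases hyD : y ≤ D
    · simp only [indicator, mem_Iic, hyD, if_true, Pi.one_apply]
      have : {c : ℝ | y + c ≤ D} = {c | D < y + c}ᶜ := by
        ext c; simp
      rw [this, prob_add_prob_compl (measurableSet_lt measurable_const (by fun_prop))]
    · simp only [indicator, mem_Iic, hyD, if_false, zero_add]
      refine measure_mono_null (t := Iic 0) (fun c (hc : y + c ≤ D) => ?_) ?_
      · exact mem_Iic.2 (by linarith)
      · have := ae_pos_expMeasure_one
        rw [ae_iff] at this
        convert! this using 2
        ext c; simp
  have h4 : expMeasure 1 (Ioi D) + expMeasure 1 (Iic D) = 1 := by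
    rw [← compl_Ioi, prob_add_prob_compl measurableSet_Ioi]
  rw [lintegral_indicator_one measurableSet_Iic, h1] at h
  simp only [h2] at h
  refine (ENNReal.add_left_inj (ENNReal.ofReal_ne_top (r := D))).1 ?_
  conv_lhs => rw [← h]
  rw [add_add_add_comm, h4, h3]

/-- The preceding identity in the clock of speed `lam a`: the first term comes from starting at `a`,
the second from arrivals at `a` with intensity `lam a`. If `lam a = 0` the second vanishes and the
first is at most 1. -/
lemma residual_le {S : Type*} {lam : S → ℝ≥0∞} {a : S} (ha : lam a ≠ ∞) (B : Set S) (t : ℝ≥0) :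
    (Iic (t : ℝ≥0∞) ×ˢ B).indicator (fun q : ℝ≥0∞ × S =>
        expMeasure 1 {c | (t : ℝ≥0∞) < q.1 + ENNReal.ofReal c / lam q.2}) (0, a) +
      lam a * ∫⁻ r in Ioi (0 : ℝ), (Iic (t : ℝ≥0∞) ×ˢ B).indicator (fun q : ℝ≥0∞ × S =>
        expMeasure 1 {c | (t : ℝ≥0∞) < q.1 + ENNReal.ofReal c / lam q.2})
        (ENNReal.ofReal r, a) ≤ B.indicator 1 a := by
  by_cases haB : a ∈ B
  swap
  · simp [indicator, haB]
  simp only [indicator, mem_prod, mem_Iic, haB, and_true, zero_le, if_true, Pi.one_apply, zero_add]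
  by_cases h0 : lam a = 0
  · rw [h0, zero_mul, add_zero]
    exact prob_le_one
  obtain ⟨l, hl, hla⟩ : ∃ l : ℝ, 0 < l ∧ lam a = ENNReal.ofReal l :=
    ⟨(lam a).toReal, ENNReal.toReal_pos h0 ha, (ENNReal.ofReal_toReal ha).symm⟩
  have ht : (t : ℝ≥0∞) = ENNReal.ofReal t := by simp
  have hm : Measurable fun y => expMeasure 1 {c | l * t < y + c} := by
    have : MeasurableSet {q : ℝ × ℝ | l * t < q.1 + q.2} :=
      measurableSet_lt measurable_const (by fun_prop)
    exact measurable_measure_prodMk_left this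
  have hkey : ∀ r : ℝ, 0 ≤ r → expMeasure 1 {c | (t : ℝ≥0∞) <
      ENNReal.ofReal r + ENNReal.ofReal c / lam a} = expMeasure 1 {c | l * t < l * r + c} := by
    intro r hr
    refine measure_congr ?_
    filter_upwards [ae_pos_expMeasure_one] with c hc
    refine propext ?_
    change (t : ℝ≥0∞) < ENNReal.ofReal r + ENNReal.ofReal c / lam a ↔ l * t < l * r + c
    rw [hla, ← ENNReal.ofReal_div_of_pos hl, ← ENNReal.ofReal_add hr (by positivity), ht,
      ENNReal.ofReal_lt_ofReal_iff_of_nonneg t.coe_nonneg, ← mul_lt_mul_iff_right₀ hl, mul_add,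
      mul_div_cancel₀ _ hl.ne']
  have h := expMeasure_one_residual (l * t)
  rw [lintegral_Ioi_scale hl _ (hm.indicator measurableSet_Iic), ← hla] at h
  rw [← h]
  gcongr ?_ + lam a * ?_
  · have := hkey 0 le_rfl
    simp only [ENNReal.ofReal_zero, zero_add, mul_zero] at this
    rw [this]
    rfl
  · refine (setLIntegral_congr_fun measurableSet_Ioi fun r hr => ?_).le
    have hr' : (0 : ℝ) < r := hr
    simp only [indicator, mem_Iic]
    have hiff : ENNReal.ofReal r ≤ t ↔ l * r ≤ l * t := by
      rw [ht, ENNReal.ofReal_le_ofReal_iff t.coe_nonneg, mul_le_mul_iff_right₀ hl]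
    simp only [hiff, hkey r hr'.le]

end Scaling

section Shift

variable {S : Type*} {f : S → I → S}

/-- The shift of the process by one jump. -/
def jumpShift (f : S → I → S) (ω : S × Noise) : S × Noise :=
  (f ω.1 (ω.2.1 0), fun k => ω.2.1 (k + 1), fun k => ω.2.2 (k + 1))

/-- Recurrence under the shift thereby becomes a statement about the holding times of a single path.
-/
lemma iterate_jumpShift (n : ℕ) : ∀ ω : S × Noise,
    (((jumpShift f)^[n] ω).1 = chain f ω.1 ω.2.1 n) ∧ ((jumpShift f)^[n] ω).2.2 0 = ω.2.2 n := by
  induction n with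
  | zero => exact fun ω => ⟨rfl, rfl⟩
  | succ n ih => exact fun ω => ih (jumpShift f ω)

end Shift

section Invariant

variable {S : Type*} [MeasurableSpace S] {f : S → I → S} {lam : S → ℝ≥0∞} {x₀ : S}

/-- Integration over the `n`-th step, conditionally on the previous ones. -/
lemma lintegral_last_step (hf : Measurable (Function.uncurry f)) (hlam : Measurable lam) (n : ℕ) :
    ∀ (G : ℝ≥0∞ × S × ℝ × S → ℝ≥0∞), Measurable G → ∀ a,
      ∫⁻ x, G (arrival f lam n a x, chain f a x.1 n, x.2 n, chain f a x.1 (n + 1)) ∂noiseLaw =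
      ∫⁻ x, ∫⁻ c, ∫⁻ u, G (arrival f lam n a x, chain f a x.1 n, c, f (chain f a x.1 n) u)
        ∂(volume : Measure I) ∂(expMeasure 1) ∂noiseLaw := by
  have hY : ∀ m a, Measurable fun x : Noise => chain f a x.1 m := fun m a =>
    (measurable_chain_noise hf m).comp (g := fun q : S × Noise => chain f q.1 q.2.1 m)
      (f := fun x => (a, x)) measurable_prodMk_left
  have hT : ∀ m a, Measurable fun x : Noise => arrival f lam m a x := fun m a =>
    measurable_arrival_right hf hlam m a
  have hG1 : ∀ m a (G : ℝ≥0∞ × S × ℝ × S → ℝ≥0∞), Measurable G → Measurable fun x : Noise =>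
      G (arrival f lam m a x, chain f a x.1 m, x.2 m, chain f a x.1 (m + 1)) := fun m a G hG =>
    hG.comp ((hT m a).prodMk ((hY m a).prodMk (Measurable.prodMk (by fun_prop) (hY (m + 1) a))))
  have hK : ∀ G : ℝ≥0∞ × S × ℝ × S → ℝ≥0∞, Measurable G → Measurable fun q : ℝ≥0∞ × S =>
      ∫⁻ c, ∫⁻ u, G (q.1, q.2, c, f q.2 u) ∂(volume : Measure I) ∂(expMeasure 1) := by
    intro G hG
    have h1 : Measurable fun q : ((ℝ≥0∞ × S) × ℝ) × I => G (q.1.1.1, q.1.1.2, q.1.2,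
        f q.1.1.2 q.2) :=
      hG.comp ((by fun_prop : Measurable fun q : ((ℝ≥0∞ × S) × ℝ) × I => q.1.1.1).prodMk
        ((by fun_prop : Measurable fun q : ((ℝ≥0∞ × S) × ℝ) × I => q.1.1.2).prodMk
          ((by fun_prop : Measurable fun q : ((ℝ≥0∞ × S) × ℝ) × I => q.1.2).prodMk
            (hf.comp (by fun_prop : Measurable fun q : ((ℝ≥0∞ × S) × ℝ) × I =>
              (q.1.1.2, q.2))))))
    exact (h1.lintegral_prod_right' (ν := (volume : Measure I))).lintegral_prod_right'
      (ν := expMeasure 1)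
  have hK1 : ∀ m a (G : ℝ≥0∞ × S × ℝ × S → ℝ≥0∞), Measurable G → Measurable fun x : Noise =>
      ∫⁻ c, ∫⁻ u, G (arrival f lam m a x, chain f a x.1 m, c, f (chain f a x.1 m) u)
        ∂(volume : Measure I) ∂(expMeasure 1) := fun m a G hG =>
    (hK G hG).comp ((hT m a).prodMk (hY m a))
  induction n with
  | zero =>
    intro G hG a
    rw [lintegral_noiseLaw _ (hG1 0 a G hG)]
    simp only [arrival_zero, chain_zero, zero_add, chain_noiseCons_succ, lintegral_const,
      measure_univ, mul_one]
    simp [noiseCons]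
  | succ n ih =>
    intro G hG a
    rw [lintegral_noiseLaw _ (hG1 (n + 1) a G hG), lintegral_noiseLaw _ (hK1 (n + 1) a G hG)]
    refine lintegral_congr fun c => lintegral_congr fun u => ?_
    simp only [arrival_noiseCons_succ, chain_noiseCons_succ]
    -- The first holding time is absorbed into `G` as a translation of time.
    exact ih (fun q => G (ENNReal.ofReal c / lam a + q.1, q.2))
      (hG.comp (by fun_prop : Measurable fun q : ℝ≥0∞ × S × ℝ × S =>
        (ENNReal.ofReal c / lam a + q.1, q.2))) (f a u)

/-- The expectation of `F` at the time and position reached by one jump from `q.2` at time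
`q.1`. -/
noncomputable def afterJump (f : S → I → S) (lam : S → ℝ≥0∞) (F : ℝ≥0∞ × S → ℝ≥0∞)
    (q : ℝ≥0∞ × S) : ℝ≥0∞ :=
  ∫⁻ c, ∫⁻ u, F (q.1 + ENNReal.ofReal c / lam q.2, f q.2 u) ∂(volume : Measure I) ∂(expMeasure 1)

lemma measurable_afterJump (hf : Measurable (Function.uncurry f)) (hlam : Measurable lam)
    {F : ℝ≥0∞ × S → ℝ≥0∞} (hF : Measurable F) : Measurable (afterJump f lam F) := by
  have h1 : Measurable fun q : ((ℝ≥0∞ × S) × ℝ) × I =>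
      F (q.1.1.1 + ENNReal.ofReal q.1.2 / lam q.1.1.2, f q.1.1.2 q.2) :=
    hF.comp (Measurable.prodMk (by fun_prop)
      (hf.comp (by fun_prop : Measurable fun q : ((ℝ≥0∞ × S) × ℝ) × I => (q.1.1.2, q.2))))
  exact (h1.lintegral_prod_right' (ν := (volume : Measure I))).lintegral_prod_right'
    (ν := expMeasure 1)

/-- Moving the last jump into the test function lowers the number of jumps while keeping the initial
law. -/
lemma lintegral_arrival_succ (hf : Measurable (Function.uncurry f)) (hlam : Measurable lam)
    {F : ℝ≥0∞ × S → ℝ≥0∞} (hF : Measurable F) (n : ℕ) (a : S) :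
    ∫⁻ x, F (arrival f lam (n + 1) a x, chain f a x.1 (n + 1)) ∂noiseLaw =
      ∫⁻ x, afterJump f lam F (arrival f lam n a x, chain f a x.1 n) ∂noiseLaw := by
  have h := lintegral_last_step hf hlam n
    (fun q : ℝ≥0∞ × S × ℝ × S => F (q.1 + ENNReal.ofReal q.2.2.1 / lam q.2.1, q.2.2.2))
    (hF.comp (by fun_prop)) a
  simpa only [← arrival_succ, afterJump] using h

/-- The renewal identity for the jumps out of `a`. -/
lemma afterJump_renewal (hf : Measurable (Function.uncurry f))
    {F : ℝ≥0∞ × S → ℝ≥0∞} (hF : Measurable F) (hF0 : ∀ b, F (∞, b) = 0) {a : S}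
    (ha : lam a ≠ ∞) :
    afterJump f lam F (0, a) + lam a * ∫⁻ r in Ioi (0 : ℝ), afterJump f lam F (ENNReal.ofReal r, a) =
      lam a * ∫⁻ r in Ioi (0 : ℝ), ∫⁻ u, F (ENNReal.ofReal r, f a u) ∂(volume : Measure I) := by
  have hfa : Measurable (f a) := hf.of_uncurry_left
  -- From an absorbing point the next jump is at time `∞`, where `F` vanishes.
  by_cases h0 : lam a = 0
  · have : afterJump f lam F (0, a) = 0 := by
      unfold afterJump
      rw [lintegral_eq_zero_iff']
      · filter_upwards [ae_pos_expMeasure_one] with c hc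
        simp [h0, ENNReal.div_zero, hc, hF0]
      · have h1 : Measurable fun q : ℝ × I => F (0 + ENNReal.ofReal q.1 / lam a, f a q.2) := by
          fun_prop
        exact (h1.lintegral_prod_right' (ν := (volume : Measure I))).aemeasurable
    rw [this, h0, zero_mul, zero_mul, zero_add]
  · obtain ⟨l, hl, hla⟩ : ∃ l : ℝ, 0 < l ∧ lam a = ENNReal.ofReal l :=
      ⟨(lam a).toReal, ENNReal.toReal_pos h0 ha, (ENNReal.ofReal_toReal ha).symm⟩
    -- In the normalized clock `y = lam a * r` the three terms become those of the rate-one renewal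
    -- identity.
    set ψ : ℝ → ℝ≥0∞ := fun y => ∫⁻ u, F (ENNReal.ofReal y / lam a, f a u) ∂(volume : Measure I)
      with hψ
    have hψm : Measurable ψ := by
      have h1 : Measurable fun q : ℝ × I => F (ENNReal.ofReal q.1 / lam a, f a q.2) := by fun_prop
      exact h1.lintegral_prod_right' (ν := (volume : Measure I))
    have hscale : ∀ r, ENNReal.ofReal (l * r) / lam a = ENNReal.ofReal r := fun r => by
      rw [ENNReal.ofReal_mul hl.le, ← hla, mul_comm, ENNReal.mul_div_cancel_right h0 ha]
    have e1 : afterJump f lam F (0, a) = ∫⁻ c, ψ c ∂(expMeasure 1) := by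
      simp [afterJump, hψ]
    have e2 : lam a * ∫⁻ r in Ioi (0 : ℝ), afterJump f lam F (ENNReal.ofReal r, a) =
        ∫⁻ y in Ioi 0, ∫⁻ c, ψ (y + c) ∂(expMeasure 1) := by
      have hm : Measurable fun y : ℝ => ∫⁻ c, ψ (y + c) ∂(expMeasure 1) := by
        have h1 : Measurable fun q : ℝ × ℝ => ψ (q.1 + q.2) := by fun_prop
        exact h1.lintegral_prod_right' (ν := expMeasure 1)
      rw [lintegral_Ioi_scale hl _ hm, ← hla]
      congr 1
      refine setLIntegral_congr_fun measurableSet_Ioi fun r hr => ?_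
      refine lintegral_congr_ae ?_
      filter_upwards [ae_pos_expMeasure_one] with c hc
      simp only [hψ]
      rw [ENNReal.ofReal_add (mul_pos hl hr).le hc.le, ENNReal.add_div, hscale]
    have e3 : lam a * ∫⁻ r in Ioi (0 : ℝ), ∫⁻ u, F (ENNReal.ofReal r, f a u) ∂(volume : Measure I) =
        ∫⁻ y in Ioi 0, ψ y := by
      rw [lintegral_Ioi_scale hl _ hψm, ← hla]
      simp only [hψ, hscale]
    rw [e1, e2, e3, lintegral_expMeasure_one_renewal ψ hψm]

/-- `π` is invariant for the jump rates: the mass that jumps into any set is equal to the mass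
that jumps out of it. -/
def IsRateInvariant (f : S → I → S) (lam : S → ℝ≥0∞) (π : Measure S) : Prop :=
  ∀ φ : S → ℝ≥0∞, Measurable φ →
    ∫⁻ a, lam a * ∫⁻ u, φ (f a u) ∂(volume : Measure I) ∂π = ∫⁻ a, lam a * φ a ∂π

/-- Started from an invariant measure, the jumps occur with intensity at most `dt λ(b) π(db)`. -/
lemma sum_lintegral_arrival_le (hf : Measurable (Function.uncurry f)) (hlam : Measurable lam)
    (hfin : ∀ a, lam a ≠ ∞) {π : Measure S} [SFinite π] (hπ : IsRateInvariant f lam π) (n : ℕ) :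
    ∀ (F : ℝ≥0∞ × S → ℝ≥0∞), Measurable F → (∀ b, F (∞, b) = 0) →
      ∑ k ∈ Finset.range n, ∫⁻ a, ∫⁻ x,
          F (arrival f lam (k + 1) a x, chain f a x.1 (k + 1)) ∂noiseLaw ∂π ≤
        ∫⁻ r in Ioi (0 : ℝ), ∫⁻ a, lam a * F (ENNReal.ofReal r, a) ∂π := by
  induction n with
  | zero => simp
  | succ n ih =>
    intro F hF hF0
    have hK := measurable_afterJump hf hlam hF
    have hK0 : ∀ b, afterJump f lam F (∞, b) = 0 := fun b => by simp [afterJump, hF0]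
    have hm1 : Measurable fun q : ℝ × S => lam q.2 * afterJump f lam F (ENNReal.ofReal q.1, q.2) :=
      by fun_prop
    have hm2 : ∀ a, Measurable fun r : ℝ => afterJump f lam F (ENNReal.ofReal r, a) := by
      fun_prop
    have hm3 : Measurable fun q : (S × ℝ) × I => F (ENNReal.ofReal q.1.2, f q.1.1 q.2) :=
      hF.comp (Measurable.prodMk (by fun_prop)
        (hf.comp (by fun_prop : Measurable fun q : (S × ℝ) × I => (q.1.1, q.2))))
    have hm4 : Measurable fun q : S × ℝ =>
        ∫⁻ u, F (ENNReal.ofReal q.2, f q.1 u) ∂(volume : Measure I) :=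
      hm3.lintegral_prod_right'
    have hm4' : ∀ a, Measurable fun r : ℝ =>
        ∫⁻ u, F (ENNReal.ofReal r, f a u) ∂(volume : Measure I) := fun a =>
      hm4.comp (g := fun q : S × ℝ => ∫⁻ u, F (ENNReal.ofReal q.2, f q.1 u) ∂(volume : Measure I))
        (f := fun r => (a, r)) measurable_prodMk_left
    have hm5 : Measurable fun q : S × ℝ =>
        lam q.1 * ∫⁻ u, F (ENNReal.ofReal q.2, f q.1 u) ∂(volume : Measure I) :=
      (hlam.comp measurable_fst).fun_mul hm4
    simp only [lintegral_arrival_succ hf hlam hF]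
    rw [Finset.sum_range_succ']
    -- With the last jump moved into the test function, induction bounds the terms having an earlier
    -- jump; the remaining one starts at time `0`. The renewal identity merges both into an integral
    -- over landing points, which rate invariance evaluates.
    calc _ ≤ (∫⁻ r in Ioi (0 : ℝ), ∫⁻ a, lam a * afterJump f lam F (ENNReal.ofReal r, a) ∂π) +
          ∫⁻ a, afterJump f lam F (0, a) ∂π := by
          gcongr
          · exact ih _ hK hK0
          · simp
      _ = ∫⁻ a, afterJump f lam F (0, a) +
          lam a * (∫⁻ r in Ioi (0 : ℝ), afterJump f lam F (ENNReal.ofReal r, a)) ∂π := by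
          rw [add_comm, lintegral_add_left (by fun_prop), lintegral_lintegral_swap
            hm1.aemeasurable]
          congr 1
          refine lintegral_congr fun a => ?_
          rw [lintegral_const_mul _ (hm2 a)]
      _ = ∫⁻ a, lam a * (∫⁻ r in Ioi (0 : ℝ), ∫⁻ u, F (ENNReal.ofReal r, f a u)
            ∂(volume : Measure I)) ∂π :=
          lintegral_congr fun a => afterJump_renewal hf hF hF0 (hfin a)
      _ = ∫⁻ a, (∫⁻ r in Ioi (0 : ℝ), lam a * ∫⁻ u, F (ENNReal.ofReal r, f a u)
            ∂(volume : Measure I)) ∂π := by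
          refine lintegral_congr fun a => ?_
          rw [lintegral_const_mul _ (hm4' a)]
      _ = ∫⁻ r in Ioi (0 : ℝ), ∫⁻ a, lam a * ∫⁻ u, F (ENNReal.ofReal r, f a u)
            ∂(volume : Measure I) ∂π :=
          lintegral_lintegral_swap hm5.aemeasurable
      _ = _ := lintegral_congr fun r => hπ (fun b => F (ENNReal.ofReal r, b)) (by fun_prop)

/-- The probability of being in `B` at time `t` after exactly `n` jumps. -/
lemma lintegral_count_eq (hf : Measurable (Function.uncurry f)) (hlam : Measurable lam)
    {B : Set S} (hB : MeasurableSet B) (t : ℝ≥0) (n : ℕ) (a : S) :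
    noiseLaw {x | arrival f lam n a x ≤ t ∧ (t : ℝ≥0∞) < arrival f lam (n + 1) a x ∧
        chain f a x.1 n ∈ B} =
      ∫⁻ x, (Iic (t : ℝ≥0∞) ×ˢ B).indicator (fun q : ℝ≥0∞ × S =>
        expMeasure 1 {c | (t : ℝ≥0∞) < q.1 + ENNReal.ofReal c / lam q.2})
        (arrival f lam n a x, chain f a x.1 n) ∂noiseLaw := by
  have hs : MeasurableSet {q : ℝ≥0∞ × S × ℝ × S | q.1 ≤ t ∧
      (t : ℝ≥0∞) < q.1 + ENNReal.ofReal q.2.2.1 / lam q.2.1 ∧ q.2.1 ∈ B} := by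
    have h1 : MeasurableSet {q : ℝ≥0∞ × S × ℝ × S | q.1 ≤ t} :=
      measurableSet_le (by fun_prop) measurable_const
    have h2 : MeasurableSet {q : ℝ≥0∞ × S × ℝ × S |
        (t : ℝ≥0∞) < q.1 + ENNReal.ofReal q.2.2.1 / lam q.2.1} :=
      measurableSet_lt measurable_const (by fun_prop)
    have h3 : Measurable fun q : ℝ≥0∞ × S × ℝ × S => q.2.1 := by fun_prop
    exact h1.inter (h2.inter (h3 hB))
  have hY : ∀ m, Measurable fun x : Noise => chain f a x.1 m := fun m =>
    (measurable_chain_noise hf m).comp (g := fun q : S × Noise => chain f q.1 q.2.1 m)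
      (f := fun x => (a, x)) measurable_prodMk_left
  have hT : ∀ m, Measurable fun x : Noise => arrival f lam m a x := fun m =>
    measurable_arrival_right hf hlam m a
  have h := lintegral_last_step hf hlam n _ (measurable_one.indicator hs) a
  have hset : MeasurableSet {x | arrival f lam n a x ≤ t ∧
      (t : ℝ≥0∞) < arrival f lam (n + 1) a x ∧ chain f a x.1 n ∈ B} :=
    (measurableSet_le (hT n) measurable_const).inter
      ((measurableSet_lt measurable_const (hT _)).inter (hY n hB))
  rw [← lintegral_indicator_one hset]
  refine Eq.trans (lintegral_congr fun x => ?_) (h.trans (lintegral_congr fun x => ?_))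
  · exact indicator_eq_indicator (by simp only [mem_ofPred_eq, arrival_succ]) rfl
  · by_cases h1 : arrival f lam n a x ≤ t ∧ chain f a x.1 n ∈ B
    · rw [indicator_of_mem (mk_mem_prod (mem_Iic.2 h1.1) h1.2),
        ← lintegral_indicator_one (measurableSet_lt measurable_const (by fun_prop))]
      refine lintegral_congr fun c => ?_
      by_cases hc : (t : ℝ≥0∞) < arrival f lam n a x + ENNReal.ofReal c / lam (chain f a x.1 n)
      · simp [indicator, h1.1, h1.2, hc]
      · simp [indicator, hc]
    · rw [indicator_of_notMem fun h => h1 ⟨h.1, h.2⟩]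
      refine lintegral_eq_zero_of_ae_eq_zero (Filter.Eventually.of_forall fun c =>
        lintegral_eq_zero_of_ae_eq_zero (Filter.Eventually.of_forall fun u =>
          indicator_of_notMem (fun h => h1 ⟨h.1, h.2.2⟩) _))

/-- A probability measure that is invariant for the rates is stationary for the jump process,
if the process does not explode. -/
theorem invariant_jumpKernel (hf : Measurable (Function.uncurry f)) (hlam : Measurable lam)
    (hfin : ∀ a, lam a ≠ ∞) {π : Measure S} [IsProbabilityMeasure π]
    (hπ : IsRateInvariant f lam π) (hne : ∀ᵐ a ∂π, NonexplosiveFrom f lam a) (t : ℝ≥0) :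
    Kernel.Invariant (jumpKernel f lam x₀ t) π := by
  have hmk := isMarkovKernel_jumpKernel (x₀ := x₀) hf hlam t
  -- Between probability measures one inequality forces equality, so upper bounds suffice.
  refine Measure.eq_of_le_of_isProbabilityMeasure (Measure.le_iff.2 fun B hB => ?_)
  rw [Measure.bind_apply hB (Kernel.aemeasurable _)]
  -- `F` weights an arrival in `B` by time `t` with the probability of staying there beyond `t`.
  set F : ℝ≥0∞ × S → ℝ≥0∞ := (Iic (t : ℝ≥0∞) ×ˢ B).indicator (fun q : ℝ≥0∞ × S =>
        expMeasure 1 {c | (t : ℝ≥0∞) < q.1 + ENNReal.ofReal c / lam q.2}) with hFdef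
  have hF : Measurable F := by
    refine Measurable.indicator ?_ (measurableSet_Iic.prod hB)
    have : MeasurableSet {q : (ℝ≥0∞ × S) × ℝ |
        (t : ℝ≥0∞) < q.1.1 + ENNReal.ofReal q.2 / lam q.1.2} :=
      measurableSet_lt measurable_const (by fun_prop)
    exact measurable_measure_prodMk_left this
  have hF0 : ∀ b, F (∞, b) = 0 := fun b => by simp [hFdef]
  have hEm : ∀ n, Measurable fun a =>
      ∫⁻ x, F (arrival f lam n a x, chain f a x.1 n) ∂noiseLaw := fun n =>
    measurable_lintegral_noise (Φ := fun q : S × Noise =>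
        F (arrival f lam n q.1 q.2, chain f q.1 q.2.1 n))
      (hF.comp ((measurable_arrival hf hlam n).prodMk (measurable_chain_noise hf n)))
  have hstep : ∀ᵐ a ∂π, jumpKernel f lam x₀ t a B ≤
      ∑' n, ∫⁻ x, F (arrival f lam n a x, chain f a x.1 n) ∂noiseLaw := by
    filter_upwards [hne] with a ha
    rw [jumpKernel_apply hf hlam, Measure.map_apply (measurable_jumpPath_right hf hlam t a) hB]
    simp only [hFdef, ← lintegral_count_eq hf hlam hB]
    refine le_trans (measure_mono_ae ?_) (measure_iUnion_le _)
    filter_upwards [ha] with x hx hxB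
    rcases exists_arrival_le_lt_or (f := f) (lam := lam) t a x with ⟨n, h1, h2⟩ | h
    · refine mem_iUnion.2 ⟨n, h1, h2, ?_⟩
      rw [← jumpPath_eq_chain (x₀ := x₀) h1 h2]
      exact hxB
    · exact absurd (hx ▸ iSup_le h) (by simp)
  calc ∫⁻ a, jumpKernel f lam x₀ t a B ∂π
      ≤ ∫⁻ a, ∑' n, ∫⁻ x, F (arrival f lam n a x, chain f a x.1 n) ∂noiseLaw ∂π :=
        lintegral_mono_ae hstep
    _ = ∑' n, ∫⁻ a, ∫⁻ x, F (arrival f lam n a x, chain f a x.1 n) ∂noiseLaw ∂π :=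
        lintegral_tsum fun n => (hEm n).aemeasurable
    _ ≤ π B := by
        refine ENNReal.tsum_le_of_sum_range_le fun n => ?_
        calc _ ≤ ∑ k ∈ Finset.range (n + 1),
              ∫⁻ a, ∫⁻ x, F (arrival f lam k a x, chain f a x.1 k) ∂noiseLaw ∂π :=
              Finset.sum_le_sum_of_subset (Finset.range_mono n.le_succ)
          _ ≤ (∫⁻ r in Ioi (0 : ℝ), ∫⁻ a, lam a * F (ENNReal.ofReal r, a) ∂π) +
              ∫⁻ a, F (0, a) ∂π := by
              -- The zero-jump term is the initial position; the others are jump arrivals,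
              -- controlled by the intensity bound.
              rw [Finset.sum_range_succ']
              gcongr
              · exact sum_lintegral_arrival_le hf hlam hfin hπ n F hF hF0
              · simp
          _ = ∫⁻ a, F (0, a) + lam a * (∫⁻ r in Ioi (0 : ℝ), F (ENNReal.ofReal r, a)) ∂π := by
              have hm : Measurable fun q : ℝ × S => lam q.2 * F (ENNReal.ofReal q.1, q.2) := by
                fun_prop
              rw [add_comm, lintegral_add_left (by fun_prop),
                lintegral_lintegral_swap hm.aemeasurable]
              congr 1
              refine lintegral_congr fun a => ?_
              rw [lintegral_const_mul _ (by fun_prop)]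
          _ ≤ ∫⁻ a, B.indicator 1 a ∂π := lintegral_mono fun a => residual_le (hfin a) B t
          _ = π B := lintegral_indicator_one hB

/-! ### Non-explosion -/

lemma measurable_jumpShift (hf : Measurable (Function.uncurry f)) : Measurable (jumpShift f) := by
  unfold jumpShift
  exact (hf.comp (by fun_prop : Measurable fun ω : S × Noise => (ω.1, ω.2.1 0))).prodMk
    (by fun_prop)

/-- After one jump the position is again distributed as `m`, and the remaining noise is independent
of it with unchanged law. -/
lemma measurePreserving_jumpShift (hf : Measurable (Function.uncurry f)) {m : Measure S}
    [SFinite m] (hm : ∀ φ : S → ℝ≥0∞, Measurable φ →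
      ∫⁻ a, ∫⁻ u, φ (f a u) ∂(volume : Measure I) ∂m = ∫⁻ a, φ a ∂m) :
    MeasurePreserving (jumpShift f) (m.prod noiseLaw) (m.prod noiseLaw) := by
  have hsh := measurable_jumpShift hf
  refine ⟨hsh, Measure.ext fun A hA => ?_⟩
  have hΦ : Measurable (A.indicator (1 : S × Noise → ℝ≥0∞)) := measurable_one.indicator hA
  have hΦs : Measurable fun ω => A.indicator (1 : S × Noise → ℝ≥0∞) (jumpShift f ω) :=
    hΦ.comp hsh
  rw [← lintegral_indicator_one hA, lintegral_map hΦ hsh, lintegral_prod _ hΦs.aemeasurable,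
    ← lintegral_indicator_one hA, lintegral_prod _ hΦ.aemeasurable,
    ← hm _ (measurable_lintegral_noise hΦ)]
  refine lintegral_congr fun a => ?_
  have h1 : Measurable fun x : Noise => A.indicator (1 : S × Noise → ℝ≥0∞) (jumpShift f (a, x)) :=
    hΦs.comp measurable_prodMk_left
  rw [lintegral_noiseLaw _ h1]
  change ∫⁻ c, ∫⁻ u, ∫⁻ x, A.indicator (1 : S × Noise → ℝ≥0∞) (f a u, x) ∂noiseLaw
    ∂(volume : Measure I) ∂(expMeasure 1) = _
  rw [lintegral_const, measure_univ, mul_one]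

/-- By recurrence, the jump process started from a finite invariant measure of its embedded chain
does not explode. -/
lemma ae_nonexplosiveFrom (hf : Measurable (Function.uncurry f)) (hlam : Measurable lam)
    (hfin : ∀ a, lam a ≠ ∞) {m : Measure S} [IsFiniteMeasure m]
    (hm : ∀ φ : S → ℝ≥0∞, Measurable φ →
      ∫⁻ a, ∫⁻ u, φ (f a u) ∂(volume : Measure I) ∂m = ∫⁻ a, φ a ∂m) :
    ∀ᵐ a ∂m, NonexplosiveFrom f lam a := by
  -- Finiteness of `m` gives Poincaré recurrence, applied below to the thresholds `1 / (k + 1)`,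
  -- which exhaust all positive holding times.
  have hcons := (measurePreserving_jumpShift hf hm).conservative
  have hhold : Measurable fun ω : S × Noise => ENNReal.ofReal (ω.2.2 0) / lam ω.1 := by fun_prop
  have hrec : ∀ᵐ ω ∂(m.prod noiseLaw), ∀ k : ℕ,
      ω ∈ {ω : S × Noise | ((k : ℝ≥0∞) + 1)⁻¹ ≤ ENNReal.ofReal (ω.2.2 0) / lam ω.1} →
      ∃ᶠ n in Filter.atTop, (jumpShift f)^[n] ω ∈
        {ω : S × Noise | ((k : ℝ≥0∞) + 1)⁻¹ ≤ ENNReal.ofReal (ω.2.2 0) / lam ω.1} :=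
    ae_all_iff.2 fun k => hcons.ae_mem_imp_frequently_image_mem
      (measurableSet_le measurable_const hhold).nullMeasurableSet
  have hpos : ∀ᵐ ω ∂(m.prod noiseLaw), 0 < ω.2.2 0 :=
    (Measure.quasiMeasurePreserving_snd (μ := m) (ν := noiseLaw)).ae ae_hold_pos
  have hall : ∀ᵐ ω ∂(m.prod noiseLaw), ⨆ n, arrival f lam n ω.1 ω.2 = ∞ := by
    filter_upwards [hrec, hpos] with ω h1 h2
    have h3 : ENNReal.ofReal (ω.2.2 0) / lam ω.1 ≠ 0 :=
      (ENNReal.div_pos (by simpa using h2) (hfin _)).ne'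
    obtain ⟨k, hk⟩ := ENNReal.exists_inv_nat_lt h3
    have hk' : ((k : ℝ≥0∞) + 1)⁻¹ ≤ ENNReal.ofReal (ω.2.2 0) / lam ω.1 :=
      le_trans (ENNReal.inv_le_inv.2 le_self_add) hk.le
    have h4 := h1 k hk'
    have h5 : ⨆ n, arrival f lam n ω.1 ω.2 =
        ∑' n, ENNReal.ofReal (ω.2.2 n) / lam (chain f ω.1 ω.2.1 n) := by
      rw [ENNReal.tsum_eq_iSup_nat]
      simp only [arrival]
    rw [h5]
    -- A convergent series has only finitely many terms above a positive threshold, contradicting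
    -- recurrence.
    by_contra hne
    have hfinite := ENNReal.finite_const_le_of_tsum_ne_top hne
      (ε := ((k : ℝ≥0∞) + 1)⁻¹) (by simp)
    rw [Nat.frequently_atTop_iff_infinite] at h4
    refine h4 (hfinite.subset fun n hn => ?_)
    have hn' : ((k : ℝ≥0∞) + 1)⁻¹ ≤ ENNReal.ofReal (((jumpShift f)^[n] ω).2.2 0) /
      lam ((jumpShift f)^[n] ω).1 := hn
    rw [(iterate_jumpShift n ω).1, (iterate_jumpShift n ω).2] at hn'
    exact hn'
  exact Measure.ae_ae_of_ae_prod hall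

end Invariant

/-! ### Existence of the jump process up to a null set -/

section Existence

variable {S : Type*} {f : S → I → S} {lam : S → ℝ≥0∞}

lemma nonexplosiveFrom_of_eq_zero {a : S} (ha : lam a = 0) : NonexplosiveFrom f lam a := by
  filter_upwards [ae_hold_pos] with x hx
  refine top_unique (le_iSup_of_le 1 ?_)
  rw [arrival_succ, arrival_zero, zero_add, chain_zero, ha, ENNReal.div_zero (by simpa using hx)]

variable [MeasurableSpace S]

lemma ae_chain_notMem (hf : Measurable (Function.uncurry f)) {N : Set S} (hN : MeasurableSet N)
    (hNf : ∀ a ∉ N, ∀ᵐ u ∂(volume : Measure I), f a u ∉ N) {a : S} (ha : a ∉ N) :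
    ∀ᵐ x ∂noiseLaw, ∀ n, chain f a x.1 n ∉ N := by
  refine ae_all_iff.2 fun n => ?_
  have hm : ∀ n a, MeasurableSet {x : Noise | chain f a x.1 n ∈ N} := fun n a =>
    ((measurable_chain_noise hf n).comp (g := fun q : S × Noise => chain f q.1 q.2.1 n)
      (f := fun x => (a, x)) measurable_prodMk_left) hN
  have key : ∀ a ∉ N, noiseLaw {x : Noise | chain f a x.1 n ∈ N} = 0 := by
    induction n with
    | zero => simp +contextual
    | succ n ih =>
      intro a ha
      rw [← lintegral_indicator_one (hm _ a),
        lintegral_noiseLaw _ (measurable_one.indicator (hm _ a))]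
      refine lintegral_eq_zero_of_ae_eq_zero (Filter.Eventually.of_forall fun c =>
        lintegral_eq_zero_of_ae_eq_zero ?_)
      filter_upwards [hNf a ha] with u hu
      exact (lintegral_indicator_one (hm n (f a u))).trans (ih _ hu)
  simpa [ae_iff] using key a ha

/-- A null set can be enlarged to a null set that the embedded chain never enters. -/
lemma exists_measurableSet_absorbing {π : Measure S} (κ : Kernel S S)
    (h : ∀ N, MeasurableSet N → π N = 0 → ∀ᵐ a ∂π, κ a N = 0) {N₀ : Set S} (hN₀ : π N₀ = 0) :
    ∃ N, MeasurableSet N ∧ N₀ ⊆ N ∧ π N = 0 ∧ ∀ a ∉ N, κ a N = 0 := by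
  -- Adjoins the points from which `κ` charges the set. Each iterate stays null by hypothesis, and
  -- the union of all iterates is closed under the operation.
  let step : Set S → Set S := fun N => N ∪ {a | κ a N ≠ 0}
  let M : ℕ → Set S := fun n => step^[n] (toMeasurable π N₀)
  have hsucc : ∀ n, M (n + 1) = M n ∪ {a | κ a (M n) ≠ 0} := fun n =>
    Function.iterate_succ_apply' step n _
  have hM : ∀ n, MeasurableSet (M n) ∧ π (M n) = 0 := by
    intro n
    induction n with
    | zero => exact ⟨measurableSet_toMeasurable _ _, by simpa [M] using hN₀⟩
    | succ n ih =>
      rw [hsucc]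
      refine ⟨ih.1.union ((Kernel.measurable_coe κ ih.1) (measurableSet_singleton 0).compl), ?_⟩
      exact measure_union_null ih.2 (by simpa [ae_iff] using h _ ih.1 ih.2)
  refine ⟨⋃ n, M n, MeasurableSet.iUnion fun n => (hM n).1,
    (subset_toMeasurable π N₀).trans (subset_iUnion M 0),
    measure_iUnion_null fun n => (hM n).2, fun a ha => measure_iUnion_null fun n => ?_⟩
  by_contra hne
  exact ha (mem_iUnion.2 ⟨n + 1, by rw [hsucc]; exact Or.inr hne⟩)

lemma isProbabilityMeasure_jumpLaw {μ : S → Measure S} (hμ : ∀ a, μ a univ < ∞) (a : S) :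
    IsProbabilityMeasure (jumpLaw μ a) := by
  unfold jumpLaw
  split_ifs with h
  · infer_instance
  · exact ⟨by simp [ENNReal.inv_mul_cancel h (hμ a).ne]⟩

lemma jumpLaw_congr {μ μ' : S → Measure S} {a : S} (h : μ a = μ' a) :
    jumpLaw μ a = jumpLaw μ' a := by
  unfold jumpLaw
  rw [h]

lemma univ_smul_jumpLaw {μ : S → Measure S} {a : S} (ha : μ a univ < ∞) :
    μ a univ • jumpLaw μ a = μ a := by
  unfold jumpLaw
  split_ifs with h
  · rw [h, zero_smul, Measure.measure_univ_eq_zero.1 h]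
  · rw [smul_smul, ENNReal.mul_inv_cancel h ha.ne, one_smul]

lemma measurable_jumpLaw (μ : Kernel S S) : Measurable (jumpLaw μ) := by
  have hlam : Measurable fun a => μ a univ := μ.measurable_coe MeasurableSet.univ
  unfold jumpLaw
  refine Measurable.ite (hlam (measurableSet_singleton 0)) Measure.measurable_dirac ?_
  refine Measure.measurable_of_measurable_coe _ fun B hB => ?_
  simp only [Measure.smul_apply, smul_eq_mul]
  exact hlam.inv.mul (μ.measurable_coe hB)

/-- The passage from flux balance, which is `hinv`, to the process. The rates are changed only on a
null set containing the points of possible explosion or of disagreement with `ρ`, and never entered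
from outside, so the change is invisible from almost every start. -/
theorem exists_stationary_jumpProcess {S : Type u} [MeasurableSpace S] [StandardBorelSpace S]
    {π : Measure S} [IsProbabilityMeasure π] (μ₀ : Kernel S S) (hμ₀ : IsRateKernel μ₀)
    (hint : ∫⁻ a, μ₀ a univ ∂π < ∞) (hinv : π.bind μ₀ = π.withDensity fun a => μ₀ a univ)
    (ρ : S → Measure S) (hρ : ∀ᵐ a ∂π, μ₀ a = ρ a) :
    ∃ μ : Kernel S S, IsRateKernel μ ∧ (∀ᵐ a ∂π, μ a = ρ a) ∧
      ∃ P : ℝ≥0 → Kernel S S, (∀ t, IsMarkovKernel (P t)) ∧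
        (∀ ν : Measure S, IsProbabilityMeasure ν →
          ∃ (Ω : Type u) (_ : MeasurableSpace Ω) (Pr : Measure Ω) (_ : IsProbabilityMeasure Pr)
            (Z : ℝ≥0 → Ω → S),
            IsMarkovJumpProcess μ P ν Z Pr ∧
            (ν ≪ π → IsMarkovJumpProcess ρ P ν Z Pr)) ∧
        (∀ t, Kernel.Invariant (P t) π) := by
  classical
  obtain ⟨x₀⟩ : Nonempty S := nonempty_of_isProbabilityMeasure π
  have hne : Nonempty S := ⟨x₀⟩
  let κ₀ : Kernel S S := ⟨jumpLaw μ₀, measurable_jumpLaw μ₀⟩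
  have hκ₀ : ∀ a, κ₀ a = jumpLaw μ₀ a := fun a => rfl
  have hmk : IsMarkovKernel κ₀ := ⟨isProbabilityMeasure_jumpLaw hμ₀⟩
  have hlam₀ : Measurable fun a => μ₀ a univ := μ₀.measurable_coe MeasurableSet.univ
  -- On a standard Borel space the jump law is the image of a uniform variable, jointly measurably
  -- in the starting point.
  obtain ⟨f₀, hf₀, hf₀κ⟩ := κ₀.exists_measurable_map_eq_unitInterval
  have hf₀a : ∀ a, Measurable (f₀ a) := fun a => hf₀.of_uncurry_left
  have hmul : ∀ φ : S → ℝ≥0∞, Measurable φ → ∀ a,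
      μ₀ a univ * ∫⁻ u, φ (f₀ a u) ∂(volume : Measure I) = ∫⁻ b, φ b ∂(μ₀ a) := by
    intro φ hφ a
    rw [← lintegral_map hφ (hf₀a a), hf₀κ, hκ₀, ← smul_eq_mul, ← lintegral_smul_measure,
      univ_smul_jumpLaw (hμ₀ a)]
  have hinv₀ : IsRateInvariant f₀ (fun a => μ₀ a univ) π := by
    intro φ hφ
    simp only [hmul φ hφ]
    rw [← Measure.lintegral_bind μ₀.aemeasurable hφ.aemeasurable, hinv,
      lintegral_withDensity_eq_lintegral_mul _ hlam₀ hφ]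
    rfl
  -- The measure `λ π` is finite by `hint` and chain-invariant by flux balance. It does not see the
  -- points of zero rate, but these are absorbing.
  have hNE₀ : ∀ᵐ a ∂π, NonexplosiveFrom f₀ (fun a => μ₀ a univ) a := by
    have hfm : IsFiniteMeasure (π.withDensity fun a => μ₀ a univ) :=
      isFiniteMeasure_withDensity hint.ne
    have h := ae_nonexplosiveFrom hf₀ hlam₀ (fun a => (hμ₀ a).ne)
      (m := π.withDensity fun a => μ₀ a univ) (fun φ hφ => by
        have hφf : Measurable fun a => ∫⁻ u, φ (f₀ a u) ∂(volume : Measure I) :=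
          (hφ.comp hf₀).lintegral_prod_right'
        rw [lintegral_withDensity_eq_lintegral_mul _ hlam₀ hφf,
          lintegral_withDensity_eq_lintegral_mul _ hlam₀ hφ]
        exact hinv₀ φ hφ)
    rw [ae_withDensity_iff hlam₀] at h
    filter_upwards [h] with a ha
    by_cases h0 : μ₀ a univ = 0
    · exact nonexplosiveFrom_of_eq_zero h0
    · exact ha h0
  -- A null set has no outflow, hence by flux balance no inflow. Where the rate is zero the jump law
  -- is a Dirac mass, which does not charge `N` from outside.
  have hκ₀null : ∀ N, MeasurableSet N → π N = 0 → ∀ᵐ a ∂π, κ₀ a N = 0 := by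
    intro N hN hπN
    have h1 : π.bind μ₀ N = 0 := by
      rw [hinv]
      exact withDensity_absolutelyContinuous _ _ hπN
    rw [Measure.bind_apply hN μ₀.aemeasurable, lintegral_eq_zero_iff (μ₀.measurable_coe hN)] at h1
    filter_upwards [h1, measure_eq_zero_iff_ae_notMem.1 hπN] with a ha haN
    rw [hκ₀]
    unfold jumpLaw
    split_ifs
    · simp [haN, hN]
    · simp only [Pi.zero_apply] at ha
      simp [ha]
  obtain ⟨N, hNm, hN₀, hπN, hNκ⟩ := exists_measurableSet_absorbing κ₀ hκ₀null
    (N₀ := {a | ¬ (μ₀ a = ρ a ∧ NonexplosiveFrom f₀ (fun a => μ₀ a univ) a)})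
    (ae_iff.1 (hρ.and hNE₀))
  have hgood : ∀ a ∉ N, μ₀ a = ρ a ∧ NonexplosiveFrom f₀ (fun a => μ₀ a univ) a := fun a ha => by
    by_contra h
    exact ha (hN₀ h)
  -- Zero rates make the points of `N` absorbing, hence non-explosive.
  let μ : Kernel S S := Kernel.piecewise hNm 0 μ₀
  have hμN : ∀ a ∈ N, μ a = 0 := fun a ha => by simp [μ, Kernel.piecewise_apply, ha]
  have hμNc : ∀ a ∉ N, μ a = μ₀ a := fun a ha => by simp [μ, Kernel.piecewise_apply, ha]
  have hμ : IsRateKernel μ := fun a => by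
    by_cases ha : a ∈ N
    · simp [hμN a ha]
    · rw [hμNc a ha]; exact hμ₀ a
  let lam : S → ℝ≥0∞ := fun a => μ a univ
  have hlam : Measurable lam := μ.measurable_coe MeasurableSet.univ
  let f : S → I → S := fun a u => if a ∈ N then a else f₀ a u
  have hf : Measurable (Function.uncurry f) :=
    Measurable.ite (hNm.preimage measurable_fst) measurable_fst hf₀
  have hfN : ∀ a ∉ N, f a = f₀ a := fun a ha => by
    funext u; simp [f, ha]
  have hlaw : ∀ a, jumpLaw μ a = (volume : Measure I).map (f a) := by
    intro a
    by_cases ha : a ∈ N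
    · have : f a = fun _ => a := by funext u; simp [f, ha]
      rw [this, Measure.map_const, measure_univ, one_smul]
      simp [jumpLaw, hμN a ha]
    · rw [hfN a ha, hf₀κ, hκ₀, jumpLaw_congr (hμNc a ha)]
  have havoid : ∀ a ∉ N, ∀ᵐ x ∂noiseLaw, ∀ n, chain f a x.1 n ∉ N := by
    intro a ha
    refine ae_chain_notMem hf hNm (fun b hb => ?_) ha
    rw [hfN b hb]
    have := hNκ b hb
    rw [← hf₀κ, Measure.map_apply (hf₀a b) hNm] at this
    exact measure_eq_zero_iff_ae_notMem.1 this
  have hchain : ∀ (n : ℕ) (a : S) (U : ℕ → I), (∀ n, chain f a U n ∉ N) →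
      chain f a U n = chain f₀ a U n := by
    intro n
    induction n with
    | zero => exact fun _ _ _ => rfl
    | succ n ih =>
      intro a U h
      have h0 : f a (U 0) = f₀ a (U 0) := by rw [hfN a (h 0)]
      have := ih (f a (U 0)) (fun k => U (k + 1)) fun n => h (n + 1)
      rw [h0] at this
      change chain f (f a (U 0)) _ n = _
      rw [h0]
      exact this
  have hNE : ∀ a, NonexplosiveFrom f lam a := by
    intro a
    by_cases ha : a ∈ N
    · exact nonexplosiveFrom_of_eq_zero (by simp [lam, hμN a ha])
    · filter_upwards [havoid a ha, (hgood a ha).2] with x hx hx₀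
      rw [← hx₀]
      refine iSup_congr fun n => ?_
      simp only [arrival]
      refine Finset.sum_congr rfl fun k _ => ?_
      rw [← hchain k a x.1 hx]
      simp only [lam, hμNc _ (hx k)]
  have hNae : ∀ᵐ a ∂π, a ∉ N := measure_eq_zero_iff_ae_notMem.1 hπN
  have hinv' : IsRateInvariant f lam π := by
    intro φ hφ
    refine Eq.trans (lintegral_congr_ae ?_) ((hinv₀ φ hφ).trans (lintegral_congr_ae ?_))
    · filter_upwards [hNae] with a ha
      simp only [lam, hμNc a ha, hfN a ha]
    · filter_upwards [hNae] with a ha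
      simp only [lam, hμNc a ha]
  refine ⟨μ, hμ, ?_, jumpKernel f lam x₀, isMarkovKernel_jumpKernel hf hlam, fun ν hν => ?_,
    invariant_jumpKernel hf hlam (fun a => (hμ a).ne) hinv' (Filter.Eventually.of_forall hNE)⟩
  · filter_upwards [hNae] with a ha
    rw [hμNc a ha, (hgood a ha).1]
  · refine ⟨S × Noise, inferInstance, startLaw ν, inferInstance,
      fun t ω => jumpPath f lam x₀ t ω.1 ω.2, ?_, fun hνπ => ?_⟩
    · exact isMarkovJumpProcess_jumpPath hf hlam (fun a => (hμ a).ne) hNE ν μ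
        (Filter.Eventually.of_forall fun ω n => rfl)
        (Filter.Eventually.of_forall fun ω n => hlaw _)
    · have hav : ∀ᵐ ω ∂(startLaw ν), ∀ n, chain f ω.1 ω.2.1 n ∉ N := by
        refine (Measure.ae_prod_iff_ae_ae ?_).2 ?_
        · exact MeasurableSet.iInter (f := fun n => {ω : S × Noise | chain f ω.1 ω.2.1 n ∉ N})
            (fun n => (measurable_chain_noise hf n) hNm.compl) |>.congr (by ext; simp)
        · filter_upwards [hνπ.ae_le hNae] with a ha using havoid a ha
      have heq : ∀ b ∉ N, ρ b = μ b := fun b hb => by rw [hμNc b hb, (hgood b hb).1]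
      refine isMarkovJumpProcess_jumpPath hf hlam (fun a => (hμ a).ne) hNE ν ρ ?_ ?_
      · filter_upwards [hav] with ω hω n
        rw [heq _ (hω n)]
      · filter_upwards [hav] with ω hω n
        rw [jumpLaw_congr (heq _ (hω n)), hlaw]

end Existence

/-! ### Rebalancing in skew-detailed balance -/

section Rebalancing

variable {S : Type*} [MeasurableSpace S]

/-- The total rate may be unbounded, so the kernel is cut into countably many bounded pieces by the
integer part of the rate. -/
lemma IsRateKernel.isSFiniteKernel {μ : Kernel S S} (hμ : IsRateKernel μ) :
    IsSFiniteKernel μ := by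
  classical
  have hlam : Measurable fun a => μ a univ := μ.measurable_coe MeasurableSet.univ
  let A : ℕ → Set S := fun n => {a | ⌊(μ a univ).toNNReal⌋₊ = n}
  have hA : ∀ n, MeasurableSet (A n) := fun n =>
    (Nat.measurable_floor.comp hlam.ennreal_toNNReal) (measurableSet_singleton n)
  have hsum : μ = Kernel.sum fun n => Kernel.piecewise (hA n) μ 0 := by
    ext a B hB
    rw [Kernel.sum_apply' _ _ hB, tsum_eq_single ⌊(μ a univ).toNNReal⌋₊]
    · rw [Kernel.piecewise_apply, if_pos (show a ∈ A _ from rfl)]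
    · intro n hn
      rw [Kernel.piecewise_apply, if_neg fun h => hn h.symm]
      simp
  have hfin : ∀ n, IsFiniteKernel (Kernel.piecewise (hA n) μ 0) := by
    refine fun n => ⟨⟨n + 1, by finiteness, fun a => ?_⟩⟩
    rw [Kernel.piecewise_apply]
    split_ifs with h
    · have h1 : (μ a univ).toNNReal < n + 1 := by
        have := Nat.lt_floor_add_one (μ a univ).toNNReal
        rwa [show ⌊(μ a univ).toNNReal⌋₊ = n from h] at this
      rw [← ENNReal.coe_toNNReal (hμ a).ne]
      exact_mod_cast h1.le
    · simp
  rw [hsum]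
  infer_instance

/-- Skew-detailed balance means that the skew exchange `(a, b) ↦ (s b, s a)` preserves the
measure `m(da) μ(a, db)`. -/
lemma SkewDetailedBalance.measurePreserving {μ : Kernel S S} [IsSFiniteKernel μ]
    (hμ : IsRateKernel μ) {s : S → S} (hs : Function.Involutive s) (hsm : Measurable s)
    {m : Measure S} [SigmaFinite m] (h : SkewDetailedBalance μ s m) :
    MeasurePreserving (fun q : S × S => (s q.2, s q.1)) (m ⊗ₘ μ) (m ⊗ₘ μ) := by
  set J := m ⊗ₘ μ with hJ
  set F : S × S → S × S := fun q => (s q.2, s q.1) with hF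
  have hFm : Measurable F := by fun_prop
  refine ⟨hFm, Measure.ext fun C hC => ?_⟩
  rw [Measure.map_apply hFm hC]
  have hlam : Measurable fun a => μ a univ := μ.measurable_coe MeasurableSet.univ
  -- The balance hypothesis only admits test functions with finite integrals. The sets `D n` built
  -- from `K n` have finite mass, exhaust the space and are invariant under the exchange, so
  -- indicators of `C ∩ D n` are admissible.
  let K : ℕ → Set S := fun n => spanningSets m n ∩ {a | μ a univ ≤ n}
  have hK : ∀ n, MeasurableSet (K n) := fun n =>
    (measurableSet_spanningSets m n).inter (measurableSet_le hlam measurable_const)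
  have hKmono : Monotone K := fun i j hij => inter_subset_inter (monotone_spanningSets m hij)
    fun a ha => (show μ a univ ≤ i from ha).trans (by exact_mod_cast hij)
  have hKU : ∀ a, ∃ n, a ∈ K n := by
    intro a
    obtain ⟨i, hi⟩ := mem_iUnion.1 ((iUnion_spanningSets m).symm ▸ mem_univ a :
      a ∈ ⋃ i, spanningSets m i)
    obtain ⟨j, hj⟩ := ENNReal.exists_nat_gt (hμ a).ne
    exact ⟨max i j, monotone_spanningSets m (le_max_left i j) hi,
      hj.le.trans (by exact_mod_cast le_max_right i j)⟩
  let D : ℕ → Set (S × S) := fun n => {q | q.1 ∈ K n ∧ s q.2 ∈ K n}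
  have hD : ∀ n, MeasurableSet (D n) := fun n =>
    (measurable_fst (hK n)).inter ((hsm.comp measurable_snd) (hK n))
  have hDmono : Monotone D := fun i j hij q hq => ⟨hKmono hij hq.1, hKmono hij hq.2⟩
  have hDU : ⋃ n, D n = univ := by
    refine eq_univ_of_forall fun q => ?_
    obtain ⟨i, hi⟩ := hKU q.1
    obtain ⟨j, hj⟩ := hKU (s q.2)
    exact mem_iUnion.2 ⟨max i j, hKmono (le_max_left i j) hi, hKmono (le_max_right i j) hj⟩
  have hFD : ∀ n, F ⁻¹' D n = D n := by
    intro n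
    ext q
    simp only [hF, D, mem_preimage, mem_ofPred_eq, hs q.1]
    exact and_comm
  have hDfin : ∀ n, J (D n) < ∞ := by
    intro n
    calc J (D n) ≤ J (K n ×ˢ univ) := measure_mono fun q hq => ⟨hq.1, trivial⟩
      _ = ∫⁻ a in K n, μ a univ ∂m := Measure.compProd_apply_prod (hK n) MeasurableSet.univ
      _ ≤ ∫⁻ a in K n, n ∂m := setLIntegral_mono measurable_const fun a ha => ha.2
      _ < ∞ := by
        rw [setLIntegral_const]
        exact ENNReal.mul_lt_top (by simp)
          ((measure_mono inter_subset_left).trans_lt (measure_spanningSets_lt_top m n))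
  have key : ∀ n, J (F ⁻¹' (C ∩ D n)) = J (C ∩ D n) := by
    intro n
    have hE : MeasurableSet (C ∩ D n) := hC.inter (hD n)
    have hE' : MeasurableSet (F ⁻¹' (C ∩ D n)) := hFm hE
    have hfin1 : J (C ∩ D n) < ∞ := (measure_mono inter_subset_right).trans_lt (hDfin n)
    have hfin2 : J (F ⁻¹' (C ∩ D n)) < ∞ :=
      (measure_mono (preimage_mono inter_subset_right)).trans_lt (by rw [hFD]; exact hDfin n)
    have hgen : ∀ E : Set (S × S), MeasurableSet E → J E < ∞ →
        (∫⁻ a, ∫⁻ b, ‖E.indicator (1 : S × S → ℝ) (a, b)‖ₑ ∂(μ a) ∂m = J E) ∧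
        ∫ a, ∫ b, E.indicator (1 : S × S → ℝ) (a, b) ∂(μ a) ∂m = J.real E := by
      intro E hE hfin
      constructor
      · rw [← Measure.lintegral_compProd (f := fun q => ‖E.indicator (1 : S × S → ℝ) q‖ₑ)
          ((measurable_one.indicator hE).enorm), ← lintegral_indicator_one hE]
        refine lintegral_congr fun q => ?_
        by_cases hq : q ∈ E <;> simp [hq]
      · rw [← Measure.integral_compProd (f := E.indicator (1 : S × S → ℝ))
          ((integrable_indicator_iff hE).2 (integrableOn_const hfin.ne)),
          integral_indicator_one hE]
    have e : ∀ a b, (C ∩ D n).indicator (1 : S × S → ℝ) (s a, s b) =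
        (F ⁻¹' (C ∩ D n)).indicator (1 : S × S → ℝ) (b, a) := fun a b => rfl
    have h1 := hgen _ hE hfin1
    have h2 := hgen _ hE' hfin2
    have h3 := h (fun a b => (C ∩ D n).indicator (1 : S × S → ℝ) (a, b))
      (measurable_one.indicator hE) (by rw [h1.1]; exact hfin1)
      (by simp only [e]; rw [h2.1]; exact hfin2)
    simp only [e] at h3
    rw [h1.2, h2.2, measureReal_eq_measureReal_iff hfin1.ne hfin2.ne] at h3
    exact h3.symm
  have hsup : ∀ E : Set (S × S), J E = ⨆ n, J (E ∩ D n) := by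
    intro E
    rw [← Monotone.measure_iUnion fun i j hij => inter_subset_inter_right _ (hDmono hij),
      ← inter_iUnion, hDU, inter_univ]
  rw [hsup, hsup C]
  refine iSup_congr fun n => ?_
  rw [← key n, preimage_inter, hFD]

variable {g : ℝ≥0 → ℝ≥0} {p : S → ℝ≥0}

/-- For positive densities this is the balance identity at `t = p b / p a`; if one density vanishes,
both sides do, by `g 0 = 0`. -/
lemma mul_balancedRate_symm (hg : IsBalancingFunction g) {S : Type*} (p : S → ℝ≥0) (a b : S) :
    p a * balancedRate g p a b = p b * balancedRate g p b a := by
  unfold balancedRate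
  by_cases ha : p a = 0 <;> by_cases hb : p b = 0
  · simp [ha, hb]
  · simp [ha, hb, hg.map_zero]
  · simp [ha, hb, hg.map_zero]
  · rw [if_pos ha, if_pos hb, hg.balance (p b / p a) (by positivity), one_div_div, ← mul_assoc,
      mul_div_cancel₀ _ ha]

/-- Rests on `g t ≤ 1 + t`: for `t ≤ 1` by monotonicity and `g 1 = 1`, for `t ≥ 1` because `g t = t
* g (1 / t) ≤ t`. -/
lemma mul_balancedRate_le (hg : IsBalancingFunction g) {S : Type*} (p : S → ℝ≥0) (a b : S) :
    p a * balancedRate g p a b ≤ p a + p b := by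
  unfold balancedRate
  have hle : ∀ t, g t ≤ 1 + t := by
    intro t
    rcases le_total t 1 with ht | ht
    · exact ((hg.monotone ht).trans hg.map_one.le).trans le_self_add
    · have h0 : 0 < t := lt_of_lt_of_le one_pos ht
      have h1 : g (1 / t) ≤ 1 := (hg.monotone (by
        rw [div_le_one h0]; exact ht)).trans hg.map_one.le
      rw [hg.balance t h0]
      exact (mul_le_of_le_one_right' h1).trans le_add_self
  split_ifs with ha
  · calc p a * g (p b / p a) ≤ p a * (1 + p b / p a) := by gcongr; exact hle _
      _ = p a + p b := by rw [mul_add, mul_one, mul_div_cancel₀ _ ha]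
  · simp

lemma measurable_balancedRate (hg : IsBalancingFunction g) (hp : Measurable p) :
    Measurable fun q : S × S => (balancedRate g p q.1 q.2 : ℝ≥0∞) := by
  classical
  have hgm := hg.monotone.measurable
  have h : Measurable fun q : S × S => balancedRate g p q.1 q.2 := by
    unfold balancedRate
    refine Measurable.ite ?_ (by fun_prop) measurable_const
    exact (hp.comp measurable_fst) (measurableSet_singleton 0).compl
  exact h.coe_nnreal_ennreal

variable {π πt : Measure S} {s : S → S} {μt : Kernel S S}

lemma measurable_totalBalancedRate [IsSFiniteKernel μt] (hg : IsBalancingFunction g)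
    (hp : Measurable p) : Measurable (totalBalancedRate g p μt) :=
  (measurable_balancedRate hg hp).lintegral_kernel_prod_right'

/-- The density is invariant under a map that preserves both measures. -/
lemma ae_density_comp_eq [SigmaFinite πt] [IsFiniteMeasure π] (hs : Function.Involutive s)
    (hsπ : MeasurePreserving s π π) (hsπt : MeasurePreserving s πt πt) (hp : Measurable p)
    (hπ : π = πt.withDensity fun a => (p a : ℝ≥0∞)) : ∀ᵐ a ∂πt, p (s a) = p a := by
  have hpe : Measurable fun a => (p a : ℝ≥0∞) := hp.coe_nnreal_ennreal
  have hps : Measurable fun a => (p (s a) : ℝ≥0∞) := hpe.comp hsπt.measurable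
  -- Both functions are densities of `π`; finiteness of `π` then gives almost everywhere uniqueness.
  have h : πt.withDensity (fun a => (p (s a) : ℝ≥0∞)) = πt.withDensity fun a => (p a : ℝ≥0∞) := by
    refine Measure.ext fun B hB => ?_
    have h1 : s ⁻¹' (s ⁻¹' B) = B := by rw [← preimage_comp, hs.comp_self, preimage_id]
    rw [← hπ, ← hsπ.measure_preimage hB.nullMeasurableSet, hπ, withDensity_apply _ hB,
      withDensity_apply _ (hsπt.measurable hB)]
    conv_lhs => rw [← h1]
    exact hsπt.setLIntegral_comp_preimage (hsπt.measurable hB) hpe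
  have hfin : ∫⁻ a, p (s a) ∂πt ≠ ∞ := by
    rw [← setLIntegral_univ, ← withDensity_apply _ MeasurableSet.univ, h, ← hπ]
    exact measure_ne_top _ _
  filter_upwards [(withDensity_eq_iff hps.aemeasurable hpe.aemeasurable hfin).1 h] with a ha
  exact_mod_cast ha

/-- The rebalanced rates are in skew-detailed balance with respect to `π`, up to the missing flips,
and have finite total intensity. -/
lemma lintegral_balanced [SigmaFinite πt] [IsFiniteMeasure π] [IsSFiniteKernel μt]
    (hs : Function.Involutive s)
    (hsπ : MeasurePreserving s π π) (hsπt : MeasurePreserving s πt πt)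
    (hμt : IsRateKernel μt) (hskew : SkewDetailedBalance μt s πt)
    (hp : Measurable p) (hπ : π = πt.withDensity fun a => (p a : ℝ≥0∞))
    (hg : IsBalancingFunction g) :
    (∀ B, MeasurableSet B → ∫⁻ a, ∫⁻ b in B, balancedRate g p a b ∂(μt a) ∂π =
      ∫⁻ a in s ⁻¹' B, totalBalancedRate g p μt a ∂π) ∧
    ∫⁻ a, totalBalancedRate g p μt a ∂π ≤ 2 * ∫⁻ a, μt a univ ∂π := by
  have hF := hskew.measurePreserving hμt hs hsπt.measurable
  have hpe : Measurable fun a => (p a : ℝ≥0∞) := hp.coe_nnreal_ennreal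
  have hpe1 : Measurable fun q : S × S => (p q.1 : ℝ≥0∞) := hpe.comp measurable_fst
  have hpe2 : Measurable fun q : S × S => (p q.2 : ℝ≥0∞) := hpe.comp measurable_snd
  have hr := measurable_balancedRate (S := S) hg hp
  have hpJ1 : ∀ᵐ q ∂(πt ⊗ₘ μt), p (s q.1) = p q.1 :=
    Measure.ae_compProd_of_ae_ae
      (measurableSet_eq_fun (hp.comp (hsπt.measurable.comp measurable_fst))
        (hp.comp measurable_fst))
      ((ae_density_comp_eq hs hsπ hsπt hp hπ).mono fun a ha => Filter.Eventually.of_forall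
        fun _ => ha)
  -- The first-coordinate statement, pulled back along the skew exchange.
  have hpJ2 : ∀ᵐ q ∂(πt ⊗ₘ μt), p (s q.2) = p q.2 := by
    filter_upwards [hF.quasiMeasurePreserving.ae hpJ1] with q hq
    simpa [hs q.2] using hq.symm
  have hJ : ∀ Φ : S × S → ℝ≥0∞, Measurable Φ →
      ∫⁻ a, ∫⁻ b, Φ (a, b) ∂(μt a) ∂π = ∫⁻ q, p q.1 * Φ q ∂(πt ⊗ₘ μt) := by
    intro Φ hΦ
    rw [hπ, lintegral_withDensity_eq_lintegral_mul _ hpe hΦ.lintegral_kernel_prod_right',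
      Measure.lintegral_compProd (by fun_prop)]
    refine lintegral_congr fun a => ?_
    simp only [Pi.mul_apply]
    rw [lintegral_const_mul]
    exact hΦ.comp measurable_prodMk_left
  have hsymm : ∀ a b, (p a : ℝ≥0∞) * balancedRate g p a b = p b * balancedRate g p b a :=
    fun a b => by exact_mod_cast mul_balancedRate_symm hg p a b
  constructor
  · intro B hB
    have hsB : MeasurableSet (s ⁻¹' B) := hsπt.measurable hB
    have hB2 : MeasurableSet (Prod.snd ⁻¹' B : Set (S × S)) := measurable_snd hB
    have hB1 : MeasurableSet (Prod.fst ⁻¹' (s ⁻¹' B) : Set (S × S)) := measurable_fst hsB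
    have e1 : ∀ a, ∫⁻ b in B, balancedRate g p a b ∂(μt a) =
        ∫⁻ b, (Prod.snd ⁻¹' B).indicator (fun q : S × S => (balancedRate g p q.1 q.2 : ℝ≥0∞))
          (a, b) ∂(μt a) := fun a => by
      rw [← lintegral_indicator hB]; rfl
    have e2 : ∀ a, (s ⁻¹' B).indicator (totalBalancedRate g p μt) a =
        ∫⁻ b, (Prod.fst ⁻¹' (s ⁻¹' B)).indicator
          (fun q : S × S => (balancedRate g p q.1 q.2 : ℝ≥0∞)) (a, b) ∂(μt a) := fun a => by
      by_cases ha : s a ∈ B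
      · simp [indicator, ha, totalBalancedRate]
      · simp [indicator, ha]
    simp only [e1]
    -- Change of variables by the skew exchange; `s`-invariance of `p` and symmetry of `p a * λ_g(a,
    -- b)` then identify the integrands.
    rw [← lintegral_indicator hsB, lintegral_congr e2, hJ _ (hr.indicator hB2),
      hJ _ (hr.indicator hB1), ← hF.lintegral_comp (hpe1.fun_mul (hr.indicator hB2))]
    refine lintegral_congr_ae ?_
    filter_upwards [hpJ1, hpJ2] with q h1 h2
    by_cases hq : s q.1 ∈ B
    · simp only [indicator, mem_preimage, hq, if_true]
      rw [hsymm q.1 q.2, h2]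
      congr 2
      simp [balancedRate, h1, h2]
    · simp [indicator, hq]
  · have h1 : ∫⁻ q, p q.1 ∂(πt ⊗ₘ μt) = ∫⁻ a, μt a univ ∂π := by
      have := hJ (fun _ => 1) measurable_const
      simp only [mul_one, lintegral_one] at this
      exact this.symm
    have h2 : ∫⁻ q, p q.2 ∂(πt ⊗ₘ μt) = ∫⁻ a, μt a univ ∂π := by
      rw [← h1, ← hF.lintegral_comp hpe2]
      refine lintegral_congr_ae ?_
      filter_upwards [hpJ1] with q hq
      simp [hq]
    unfold totalBalancedRate
    rw [hJ (fun q => (balancedRate g p q.1 q.2 : ℝ≥0∞)) hr]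
    calc _ ≤ ∫⁻ q, (p q.1 : ℝ≥0∞) + p q.2 ∂(πt ⊗ₘ μt) :=
          lintegral_mono fun q => by
            rw [← ENNReal.coe_mul, ← ENNReal.coe_add]
            exact ENNReal.coe_le_coe.2 (mul_balancedRate_le hg p q.1 q.2)
      _ = _ := by rw [lintegral_add_left (by fun_prop), h1, h2, two_mul]

lemma rebalanced_apply (a : S) {B : Set S} (hB : MeasurableSet B) :
    rebalanced g p s μt a B = ∫⁻ b in B, balancedRate g p a b ∂(μt a) +
      flipRate g p s μt a * B.indicator 1 (s a) := by
  rw [rebalanced, Measure.add_apply, withDensity_apply _ hB, Measure.smul_apply,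
    Measure.dirac_apply' _ hB, smul_eq_mul]

/-- `x + (y - x)⁺ = max x y`, also at infinite values. The purpose of the flips is this symmetry of
the total rate under `s`. -/
lemma rebalanced_univ (a : S) : rebalanced g p s μt a univ =
    max (totalBalancedRate g p μt (s a)) (totalBalancedRate g p μt a) := by
  rw [rebalanced_apply a MeasurableSet.univ]
  simp only [Measure.restrict_univ, indicator_univ, Pi.one_apply, mul_one, flipRate]
  exact add_tsub_eq_max.trans (max_comm _ _)

lemma measurable_rebalanced [IsSFiniteKernel μt] (hg : IsBalancingFunction g)
    (hp : Measurable p) (hs : Measurable s) : Measurable (rebalanced g p s μt) := by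
  have hlam := measurable_totalBalancedRate (μt := μt) hg hp
  have hr := measurable_balancedRate (S := S) hg hp
  refine Measure.measurable_of_measurable_coe _ fun B hB => ?_
  simp only [rebalanced_apply _ hB]
  refine Measurable.add ?_ (((hlam.comp hs).sub hlam).mul ((measurable_one.indicator hB).comp hs))
  exact hr.setLIntegral_kernel_prod_right hB

end Rebalancing

end JumpSampler

/-! ### Flux balance of the rebalanced rates and the main theorem -/

open JumpSampler in
theorem theorem2 {S : Type u} [TopologicalSpace S] [PolishSpace S] [MeasurableSpace S]
    [BorelSpace S]
    (π : Measure S) [IsProbabilityMeasure π]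
    (πt : Measure S) [SigmaFinite πt] (hac : π ≪ πt)
    (s : S → S) (hs : Function.Involutive s)
    (hsπ : MeasurePreserving s π π) (hsπt : MeasurePreserving s πt πt)
    (μt : Kernel S S) (hμt : JumpSampler.IsRateKernel μt)
    (hskew : JumpSampler.SkewDetailedBalance μt s πt)
    (hrate : ∫⁻ a, μt a Set.univ ∂π < ∞)
    (p : S → ℝ≥0) (hp : Measurable p)
    (hpd : (fun a => (p a : ℝ≥0∞)) =ᵐ[πt] π.rnDeriv πt)
    (g : ℝ≥0 → ℝ≥0) (hg : JumpSampler.IsBalancingFunction g) :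
    ∃ μ : Kernel S S, JumpSampler.IsRateKernel μ ∧
      (∀ᵐ a ∂π, μ a = JumpSampler.rebalanced g p s μt a) ∧
      ∃ P : ℝ≥0 → Kernel S S, (∀ t, IsMarkovKernel (P t)) ∧
        (∀ ν : Measure S, IsProbabilityMeasure ν →
          ∃ (Ω : Type u) (_ : MeasurableSpace Ω) (Pr : Measure Ω) (_ : IsProbabilityMeasure Pr)
            (Z : ℝ≥0 → Ω → S),
            JumpSampler.IsMarkovJumpProcess μ P ν Z Pr ∧
            (ν ≪ π →
              JumpSampler.IsMarkovJumpProcess (JumpSampler.rebalanced g p s μt) P ν Z Pr)) ∧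
        (∀ t, Kernel.Invariant (P t) π) := by
  classical
  have hsf := hμt.isSFiniteKernel
  have hπ : π = πt.withDensity fun a => (p a : ℝ≥0∞) := by
    rw [withDensity_congr_ae hpd, Measure.withDensity_rnDeriv_eq _ _ hac]
  obtain ⟨hbal, hle⟩ := lintegral_balanced hs hsπ hsπt hμt hskew hp hπ hg
  have hlam := measurable_totalBalancedRate (μt := μt) hg hp
  have hlams : Measurable fun a => totalBalancedRate g p μt (s a) := hlam.comp hsπ.measurable
  have hfin : ∫⁻ a, totalBalancedRate g p μt a ∂π < ∞ :=
    hle.trans_lt (ENNReal.mul_lt_top (by simp) hrate)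
  have hfins : ∫⁻ a, totalBalancedRate g p μt (s a) ∂π < ∞ := by
    rwa [hsπ.lintegral_comp hlam]
  -- The mean total rate is finite, so `N` is `π`-null; setting the kernel to zero on it gives a
  -- rate kernel.
  set N : Set S := {a | rebalanced g p s μt a Set.univ = ∞} with hN
  have hρm := measurable_rebalanced (μt := μt) hg hp hsπ.measurable
  have hρu : Measurable fun a => rebalanced g p s μt a Set.univ :=
    (Measure.measurable_coe MeasurableSet.univ).comp hρm
  have hNm : MeasurableSet N := hρu (measurableSet_singleton ∞)
  have hρfin : ∫⁻ a, rebalanced g p s μt a Set.univ ∂π < ∞ := by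
    simp only [rebalanced_univ]
    calc _ ≤ ∫⁻ a, totalBalancedRate g p μt (s a) + totalBalancedRate g p μt a ∂π :=
          lintegral_mono fun a => max_le_add_of_nonneg zero_le zero_le
      _ < ∞ := by
          rw [lintegral_add_left hlams]
          exact ENNReal.add_lt_top.2 ⟨hfins, hfin⟩
  let ρ : Kernel S S := ⟨rebalanced g p s μt, hρm⟩
  let μ₀ : Kernel S S := Kernel.piecewise hNm 0 ρ
  have hμ₀ : ∀ᵐ a ∂π, μ₀ a = rebalanced g p s μt a := by
    filter_upwards [ae_lt_top hρu hρfin.ne] with a ha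
    rw [Kernel.piecewise_apply, if_neg (show a ∉ N from ha.ne)]
    rfl
  have hrk : IsRateKernel μ₀ := by
    intro a
    rw [Kernel.piecewise_apply]
    split_ifs with h
    · simp
    · exact lt_top_iff_ne_top.2 h
  have hint : ∫⁻ a, μ₀ a Set.univ ∂π < ∞ := by
    rwa [lintegral_congr_ae (hμ₀.mono fun a ha => by rw [ha])]
  refine exists_stationary_jumpProcess μ₀ hrk hint ?_ _ hμ₀
  -- The `λ_g`-flow into `B` is the outflow of `s ⁻¹' B`, and the flips complete it to the integral
  -- of the maximum over `s ⁻¹' B`. By `s`-invariance of `π` and of the maximum, this is the outflow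
  -- of `B`.
  refine Measure.ext fun B hB => ?_
  have hsB : MeasurableSet (s ⁻¹' B) := hsπ.measurable hB
  have hmax : Measurable fun a =>
      max (totalBalancedRate g p μt (s a)) (totalBalancedRate g p μt a) := hlams.max hlam
  rw [Measure.bind_apply hB μ₀.aemeasurable, withDensity_apply _ hB,
    lintegral_congr_ae (hμ₀.mono fun a ha => by rw [ha]),
    lintegral_congr_ae (ae_restrict_of_ae (hμ₀.mono fun a ha => by rw [ha]))]
  simp only [rebalanced_univ, rebalanced_apply _ hB]
  have hflip : ∀ a, flipRate g p s μt a * B.indicator 1 (s a) =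
      (s ⁻¹' B).indicator (flipRate g p s μt) a := fun a => by
    by_cases ha : s a ∈ B <;> simp [Set.indicator, ha]
  have hflipm : Measurable (flipRate g p s μt) := hlams.sub hlam
  simp only [hflip]
  rw [lintegral_add_right _ (hflipm.indicator hsB), hbal B hB, lintegral_indicator hsB,
    ← lintegral_add_right _ hflipm, ← hsπ.setLIntegral_comp_preimage hB hmax]
  refine lintegral_congr fun a => ?_
  rw [hs a, max_comm (totalBalancedRate g p μt a)]
  exact add_tsub_eq_max.trans (max_comm _ _)
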